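/- **Setting.** For $d\ge 1$ let $[d]=\{0,\dots,d-1\}$. The de Bruijn graph $B(d,3)$ has as nodes the words $xyz$ with $x,y,z\in[d]$, and there is an edge $x_1x_2x_3\to y_1y_2y_3$ iff $x_2x_3=y_1y_2$. A *maximum independent set* (MIS) of $B(d,3)$ is a largest set of nodes no two distinct members of which are joined by an edge in either direction; the edges $xxx\to xxx$ are thus disregarded. The symmetric group $\mathbb S_d$ of permutations of $[d]$ acts on nodes digit by digit, and hence on sets of nodes and on MISs. For an MIS $S$ let $L(S)=\{x\in[d] : xxx\in S\}$ be its set of *loops*. A *distinguished loop* of $S$ is a loop $a\in L(S)$ such that $aya\in S$ for every $y\in[d]$. For a word $w$, write $w|_{x\to y}$ for the word obtained by replacing every occurrence of $x$ by $y$. **Operations.** Let $S$ be an MIS of $B(d,3)$, $d\ge 1$, with distinguished loop $a$, and put $R=[d]\setminus L(S)$. For a new digit $y$ let $$C_y=\{w|_{a\to y} : w\in S,\ a\in w,\ w\ne aaa,\ w\neq aba \text{ for every } b\in L(S)\setminus\{a\}\}\cup\{axy,\ yxa : x\in R\}\cup\{uyv : u,v\in L(S)\}.$$ With the single new digit $d$,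 define subsets of $B(d+1,3)$ by $$f(S)=S\cup C_d\cup\{udd : u\in L(S)\},\qquad f'(S)=S\cup C_d\cup\{ddu : u\in L(S)\}.$$ With the two new digits $d,d+1$, and with $(y,z)$ ranging over $(d,d+1)$ and $(d+1,d)$, define subsets of $B(d+2,3)$ by $$g(S)=S\cup\bigcup_{(y,z)}\Bigl(C_y\cup\{yxz : x\in R\}\cup\{uyy,\ yzu : u\in L(S)\}\cup\{yzz\}\Bigr),$$ $$g'(S)=S\cup\bigcup_{(y,z)}\Bigl(C_y\cup\{yxz : x\in R\}\cup\{yyu,\ uyz : u\in L(S)\}\cup\{yyz\}\Bigr).$$ **Theorem (Characterization of the maximum independent sets of $B(d,3)$).** For all $d\ge 1$: 1. Every MIS $S$ of $B(d,3)$ has exactly one distinguished loop, and each of $f,f',g,g'$ sends MISs to MISs. The image of the orbit of $S$ under such an operation, saturated under permutations of the larger alphabet, is exactly the orbit of the image of $S$, so the operations act on orbits of MISs. Every $\mathbb S_d$-orbit of MISs of $B(d,3)$ is obtained by exactly one choice of a starting point, either $\{000\}$ (an MIS of $B(1,3)$) or the $\mathbb S_2$-orbit of $\{000,010,111\}$ (an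 orbit of MISs of $B(2,3)$), and of a finite, possibly empty, sequence of applications of $f,f',g,g'$. Conversely, everything so obtained is an orbit of MISs. 2. If $S$ is an MIS of $B(d,3)$, its stabilizer in $\mathbb S_d$ is generated by a set of pairwise disjoint transpositions. In particular its order is a power of $2$. 3. Let $b_{d,k}$ be the number of $\mathbb S_d$-orbits of MISs of $B(d,3)$ whose elements have stabilizers of order $2^k$. Then $b_{1,0}=1$, $b_{2,0}=3$, $b_{1,k}=b_{2,k}=0$ for $k\ge1$, and $$b_{d,k}=2b_{d-1,k}+2b_{d-2,k-1}\qquad(d\ge 3,\ k\ge 0),$$ where $b_{d-2,-1}=0$; and, as formal power series, $$\sum_{d\ge1}\sum_{k\ge0}b_{d,k}t^ds^k=\frac{t+t^2}{1-2t-2t^2s}.$$ 4. Let $a_d$ be the number of MISs of $B(d,3)$. Then $a_1=1$, $a_2=6$, $$a_d=2d\,a_{d-1}+d(d-1)\,a_{d-2}\qquad(d\ge 3),$$ and, as formal power series, $$\sum_{d\ge1}\frac{a_dt^d}{d!}=\frac{t+t^2}{1-2t-t^2}.$$ -/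

import Mathlib

open scoped Pointwise

noncomputable section

namespace DeBruijn

/-- The de Bruijn graph `B(d,D)`: its nodes are the `D`-digit words over the alphabet
`{0, …, d-1}`, with an edge `x → y` iff `x₂ … x_D = y₁ … y_{D-1}`. -/
def graph (d D : ℕ) : Digraph (Fin D → Fin d) where
  Adj x y := ∀ (i : ℕ) (h : i + 1 < D), x ⟨i + 1, h⟩ = y ⟨i, Nat.lt_of_succ_lt h⟩

/-- The nodes of `B(d,3)`; the word `x y z` is `![x, y, z]`. -/
abbrev Word (d : ℕ) : Type := Fin 3 → Fin d

/-- Maximum independent sets (MISs) of `B(d,3)`. The passage to the underlying simple graph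
forgets the orientation and removes the edges from a node to itself, so that constant words
may belong to an MIS. -/
def IsMIS {d : ℕ} (S : Set (Word d)) : Prop :=
  (graph d 3).toSimpleGraphInclusive.IsMaximumIndepSet S.toFinite.toFinset

/-- The digits `y` that do not appear between `x` in `A`. -/
def missing {d : ℕ} (x : Fin d) (A : Set (Word d)) : Set (Fin d) :=
  {y | ![x, y, x] ∉ A}

/-- `m_x(A)`, the number of digits that do not appear between `x` in `A`. -/
def m {d : ℕ} (x : Fin d) (A : Set (Word d)) : ℕ := (missing x A).ncard

/-- The set `L(S)` of loops of `S`; the loop `xxx` is identified with the digit `x`. -/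
def loops {d : ℕ} (S : Set (Word d)) : Set (Fin d) := {x | ![x, x, x] ∈ S}

/-- `a` is a distinguished loop of `S`. -/
def IsDistinguished {d : ℕ} (S : Set (Word d)) (a : Fin d) : Prop :=
  a ∈ loops S ∧ m a S = 0

/-- The word obtained from `w` by replacing every occurrence of the digit `x` by `y`. -/
def repl {d : ℕ} (w : Word d) (x y : Fin d) : Word d := fun i => if w i = x then y else w i

/-- A digit of `{0, …, d-1}`, seen as a digit of `{0, …, d+n-1}`. -/
abbrev up {d : ℕ} (n : ℕ) (x : Fin d) : Fin (d + n) := Fin.castAdd n x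

/-- A word over `{0, …, d-1}`, seen as a word over `{0, …, d+n-1}`. -/
def upWord {d : ℕ} (n : ℕ) (w : Word d) : Word (d + n) := fun i => up n (w i)

/-- The words `w[a → y]`, for the words `w` of `S` that contain `a` and are neither `aaa` nor
`aba`, where `b` is the loop of `S` other than `a`, if there is one. Here `y` is a digit of the
larger alphabet. -/
def replSet {d : ℕ} (n : ℕ) (S : Set (Word d)) (a : Fin d) (y : Fin (d + n)) :
    Set (Word (d + n)) :=
  {v | ∃ w ∈ S, (∃ i, w i = a) ∧ w ≠ ![a, a, a] ∧ (∀ b ∈ loops S, b ≠ a → w ≠ ![a, b, a]) ∧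
    v = repl (upWord n w) (up n a) y}

/-- The words `a x y` with `x` a non-loop. -/
def leftSet {d : ℕ} (n : ℕ) (S : Set (Word d)) (a : Fin d) (y : Fin (d + n)) :
    Set (Word (d + n)) :=
  {v | ∃ x : Fin d, x ∉ loops S ∧ v = ![up n a, up n x, y]}

/-- The words `y x a` with `x` a non-loop. -/
def rightSet {d : ℕ} (n : ℕ) (S : Set (Word d)) (a : Fin d) (y : Fin (d + n)) :
    Set (Word (d + n)) :=
  {v | ∃ x : Fin d, x ∉ loops S ∧ v = ![y, up n x, up n a]}

/-- The words `u y v` with `u` and `v` loops. -/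
def midSet {d : ℕ} (n : ℕ) (S : Set (Word d)) (y : Fin (d + n)) : Set (Word (d + n)) :=
  {v | ∃ u ∈ loops S, ∃ u' ∈ loops S, v = ![up n u, y, up n u']}

/-- The words `y x z` with `x` a non-loop. -/
def betweenSet {d : ℕ} (n : ℕ) (S : Set (Word d)) (y z : Fin (d + n)) : Set (Word (d + n)) :=
  {v | ∃ x : Fin d, x ∉ loops S ∧ v = ![y, up n x, z]}

/-- The words `u y z` with `u` a loop. -/
def loopFirst {d : ℕ} (n : ℕ) (S : Set (Word d)) (y z : Fin (d + n)) : Set (Word (d + n)) :=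
  {v | ∃ u ∈ loops S, v = ![up n u, y, z]}

/-- The words `y z u` with `u` a loop. -/
def loopLast {d : ℕ} (n : ℕ) (S : Set (Word d)) (y z : Fin (d + n)) : Set (Word (d + n)) :=
  {v | ∃ u ∈ loops S, v = ![y, z, up n u]}

/-- The digit `d` of the alphabet `{0, …, d}`. -/
abbrev new (d : ℕ) : Fin (d + 1) := Fin.last d

/-- The digit `d` of the alphabet `{0, …, d+1}`. -/
abbrev new₀ (d : ℕ) : Fin (d + 2) := Fin.natAdd d 0

/-- The digit `d + 1` of the alphabet `{0, …, d+1}`. -/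
abbrev new₁ (d : ℕ) : Fin (d + 2) := Fin.natAdd d 1

/-- The part that `f(S)` and `f'(S)` have in common. -/
def fCore {d : ℕ} (S : Set (Word d)) (a : Fin d) : Set (Word (d + 1)) :=
  upWord 1 '' S ∪ replSet 1 S a (new d) ∪ leftSet 1 S a (new d) ∪ rightSet 1 S a (new d) ∪
    midSet 1 S (new d)

/-- The operation `f`. The distinguished loop `a` of an MIS is unique (for `d > 0`), so the
existential quantifier only names it. -/
def opF {d : ℕ} (S : Set (Word d)) : Set (Word (d + 1)) :=
  {w | ∃ a, IsDistinguished S a ∧ w ∈ fCore S a ∪ loopFirst 1 S (new d) (new d)}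

/-- The operation `f'`. -/
def opF' {d : ℕ} (S : Set (Word d)) : Set (Word (d + 1)) :=
  {w | ∃ a, IsDistinguished S a ∧ w ∈ fCore S a ∪ loopLast 1 S (new d) (new d)}

/-- The part that `g(S)` and `g'(S)` have in common. -/
def gCore {d : ℕ} (S : Set (Word d)) (a : Fin d) : Set (Word (d + 2)) :=
  upWord 2 '' S ∪
    (replSet 2 S a (new₀ d) ∪ replSet 2 S a (new₁ d)) ∪
    (leftSet 2 S a (new₀ d) ∪ leftSet 2 S a (new₁ d)) ∪
    (rightSet 2 S a (new₀ d) ∪ rightSet 2 S a (new₁ d)) ∪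
    (betweenSet 2 S (new₀ d) (new₁ d) ∪ betweenSet 2 S (new₁ d) (new₀ d)) ∪
    (midSet 2 S (new₀ d) ∪ midSet 2 S (new₁ d))

/-- The operation `g`. -/
def opG {d : ℕ} (S : Set (Word d)) : Set (Word (d + 2)) :=
  {w | ∃ a, IsDistinguished S a ∧ w ∈ gCore S a ∪
    (loopFirst 2 S (new₀ d) (new₀ d) ∪ loopFirst 2 S (new₁ d) (new₁ d)) ∪
    (loopLast 2 S (new₀ d) (new₁ d) ∪ loopLast 2 S (new₁ d) (new₀ d)) ∪
    {![new₀ d, new₁ d, new₁ d], ![new₁ d, new₀ d, new₀ d]}}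

/-- The operation `g'`. -/
def opG' {d : ℕ} (S : Set (Word d)) : Set (Word (d + 2)) :=
  {w | ∃ a, IsDistinguished S a ∧ w ∈ gCore S a ∪
    (loopLast 2 S (new₀ d) (new₀ d) ∪ loopLast 2 S (new₁ d) (new₁ d)) ∪
    (loopFirst 2 S (new₀ d) (new₁ d) ∪ loopFirst 2 S (new₁ d) (new₀ d)) ∪
    {![new₁ d, new₁ d, new₀ d], ![new₀ d, new₀ d, new₁ d]}}

/-- Names of the four operations. -/
inductive Op where
  | f | f' | g | g'

/-- The number of digits that an operation adds to the alphabet. -/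
def Op.deg : Op → ℕ
  | .f => 1
  | .f' => 1
  | .g => 2
  | .g' => 2

/-- The four operations on sets of nodes. -/
def Op.apply {d : ℕ} : (o : Op) → Set (Word d) → Set (Word (d + o.deg))
  | .f, S => opF S
  | .f', S => opF' S
  | .g, S => opG S
  | .g', S => opG' S

/-- The orbit of `S` under the symmetric group `S_d`, acting digit by digit. -/
abbrev orbit {d : ℕ} (S : Set (Word d)) : Set (Set (Word d)) :=
  MulAction.orbit (Equiv.Perm (Fin d)) S

/-- The stabilizer of `S` in the symmetric group `S_d`. -/
abbrev stab {d : ℕ} (S : Set (Word d)) : Subgroup (Equiv.Perm (Fin d)) :=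
  MulAction.stabilizer (Equiv.Perm (Fin d)) S

/-- `Ω` is an `S_d`-orbit of MISs of `B(d,3)`. -/
def IsMISOrbit {d : ℕ} (Ω : Set (Set (Word d))) : Prop :=
  ∃ S, IsMIS S ∧ Ω = orbit S

/-- The operation on orbits: all sets in the orbit of `o(S)` for some `S` in `Ω`. -/
def Op.onOrbit {d : ℕ} (o : Op) (Ω : Set (Set (Word d))) : Set (Set (Word (d + o.deg))) :=
  ⋃ S ∈ Ω, orbit (o.apply S)

/-- The two starting points, `{000}` and the orbit of `{000, 010, 111}`. -/
inductive Seed where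
  | one | two

/-- The alphabet size of a starting point, together with its orbit. -/
def Seed.start : Seed → (d : ℕ) × Set (Set (Word d))
  | .one => ⟨1, {{![0, 0, 0]}}⟩
  | .two => ⟨2, orbit {![0, 0, 0], ![0, 1, 0], ![1, 1, 1]}⟩

/-- The alphabet size and the orbit that result from a starting point when the operations in the
list `l` are applied one after the other, the head of `l` first. -/
def run (s : Seed) (l : List Op) : (d : ℕ) × Set (Set (Word d)) :=
  l.foldl (fun Ω o => ⟨Ω.1 + o.deg, o.onOrbit Ω.2⟩) s.start

/-- `a_d`, the number of MISs of `B(d,3)`. -/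
def a (d : ℕ) : ℕ := {S : Set (Word d) | IsMIS S}.ncard

/-- `b_{d,k}`, the number of orbits of MISs of `B(d,3)` whose elements have stabilizers of
size `2 ^ k`. -/
def b (d k : ℕ) : ℕ :=
  {Ω : Set (Set (Word d)) | IsMISOrbit Ω ∧ ∀ S ∈ Ω, Nat.card (stab S) = 2 ^ k}.ncard

/-- The formal power series `∑_{d ≥ 1} a_d t^d / d!`. -/
def aSeries : PowerSeries ℚ :=
  PowerSeries.mk fun d => if d = 0 then 0 else (a d : ℚ) / d.factorial

/-- The formal power series `∑_{d ≥ 1} ∑_{k ≥ 0} b_{d,k} t^d s^k` in `t` (the variable `0`) and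
`s` (the variable `1`). -/
def bSeries : MvPowerSeries (Fin 2) ℚ :=
  fun e => if e 0 = 0 then 0 else (b (e 0) (e 1) : ℚ)

/-- The variable `t` of the formal power series in `t` and `s`. -/
abbrev t : MvPowerSeries (Fin 2) ℚ := MvPowerSeries.X 0

/-- The variable `s` of the formal power series in `t` and `s`. -/
abbrev s : MvPowerSeries (Fin 2) ℚ := MvPowerSeries.X 1

end DeBruijn

end

namespace DeBruijn

/-! An independent set is governed by its loops and by its tails, the pairs that begin its other
words: independence means that a tail never ends a word. All words compatible with such data form an
independent set `Cfg.words`, so MISs are the configurations `Cfg` that maximise `val`, the number of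
loops plus the sum of p(y)q(y), where p(y) counts the tails ending in y and q(y) the heads beginning
with y.

For the bound put s(y) = p(y) + q(y), plus 1 if y is a loop. The share of y in `val` is at most
⌊s(y)²/4⌋, with an extra 1 for an isolated loop, of which there is at most one. Write ⌊s²/4⌋ as the
sum over j of the truncated differences s - (2j+1), and sum over y first. The s(y) of a set Y add up
to |Y|² plus a nonnegative excess, so level j contributes at most (n-j)(n-j-1), and `alpha n` bounds
the total. `Cfg.alpha_sub_val` writes the deficit as a sum of terms that are all nonnegative. In an
MIS they vanish (`Cfg.val_le_and`), which makes the level sets tight, with j or j+1 elements at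
level j. Hence there are one or two loops, and directly above them a layer of one or two digits on
which the tails are given by equality or by inequality (`Cfg.low_card_loops`, `Cfg.exists_layer`).

The operations insert exactly such a layer (`Cfg.apply_words`): one digit for f and f', two for g
and g'. Removing the layer again leaves a smaller MIS (`Cfg.exists_apply`), and only the two seeds
have nothing but loops. The inserted digits can be recognised: among the non-loops they are those
between which the fewest digits are missing (`Cfg.m_ext_eq_iff`). A permutation between two images
therefore splits into one of the old digits and one of the new ones. This gives uniqueness
(`run_injective`) and multiplies the stabilizer by the symmetric group of the layer
(`Cfg.stab_apply`). The counts follow by enumerating sequences of operations and by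
orbit-stabilizer. -/

lemma swap_conj_iff : ∀ a x y z : Fin 2,
    ((x = y ∧ y = z) ∨ (x = a ∧ y ≠ a) ∧ ¬ (y = a ∧ z ≠ a) ∧ ¬ y = z) ↔
      ((Equiv.swap 0 a x = Equiv.swap 0 a y ∧ Equiv.swap 0 a y = Equiv.swap 0 a z) ∨
        (Equiv.swap 0 a x = 0 ∧ Equiv.swap 0 a y = 1) ∧
        ¬ (Equiv.swap 0 a y = 0 ∧ Equiv.swap 0 a z = 1) ∧
        ¬ Equiv.swap 0 a y = Equiv.swap 0 a z) := by
  decide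

/-- The right side is the shape that membership takes when every digit is a loop and 01 is the only
tail. -/
lemma two_iff : ∀ x y z : Fin 2, ((x = 0 ∧ y = 0 ∧ z = 0) ∨ (x = 0 ∧ y = 1 ∧ z = 0) ∨
    (x = 1 ∧ y = 1 ∧ z = 1)) ↔
    ((x = y ∧ y = z) ∨ (x = 0 ∧ y = 1) ∧ ¬ (y = 0 ∧ z = 1) ∧ ¬ y = z) := by
  decide

/-! ### Configurations of loops, tails and heads -/

open Finset
open scoped Classical

/-- A set of loops together with a set of pairs that may be the first two digits of a word
(tails); the other pairs, except `xx` for the loops `x`, may be the last two digits (heads). -/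
structure Cfg (n : ℕ) where
  X : Finset (Fin n)
  T : Fin n → Fin n → Prop
  loop : ∀ x ∈ X, ¬ T x x

namespace Cfg

variable {n : ℕ} (c : Cfg n)

/-- The heads. -/
def H (x y : Fin n) : Prop := ¬ c.T x y ∧ ¬ (x = y ∧ x ∈ c.X)

/-- The set of words of a configuration. -/
def words : Set (Word n) :=
  {w | (w 0 = w 1 ∧ w 1 = w 2 ∧ w 0 ∈ c.X) ∨ (c.T (w 0) (w 1) ∧ c.H (w 1) (w 2))}

/-- The number of tails that end in `y`. -/
noncomputable def p (y : Fin n) : ℕ := #{x | c.T x y}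

/-- The number of heads that begin with `y`. -/
noncomputable def q (y : Fin n) : ℕ := #{z | c.H y z}

/-- The number of words of a configuration. -/
noncomputable def val : ℕ := #c.X + ∑ y, c.p y * c.q y

lemma mem_words {x y z : Fin n} :
    ![x, y, z] ∈ c.words ↔ (x = y ∧ y = z ∧ x ∈ c.X) ∨ (c.T x y ∧ c.H y z) := Iff.rfl

lemma mem_loops {x : Fin n} : x ∈ loops c.words ↔ x ∈ c.X := by
  simp only [loops, Set.mem_ofPred_eq, mem_words, H]
  tauto

lemma loops_words : loops c.words = c.X := Set.ext fun _ => c.mem_loops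

end Cfg

lemma word_eta {n : ℕ} (w : Word n) : w = ![w 0, w 1, w 2] := by
  ext i; fin_cases i <;> rfl

lemma word_eq {n : ℕ} {x y z x' y' z' : Fin n} :
    (![x, y, z] : Word n) = ![x', y', z'] ↔ x = x' ∧ y = y' ∧ z = z' := by
  constructor
  · intro h
    exact ⟨congrFun h 0, congrFun h 1, congrFun h 2⟩
  · rintro ⟨rfl, rfl, rfl⟩; rfl

lemma graph_adj {n : ℕ} {v w : Word n} : (graph n 3).Adj v w ↔ v 1 = w 0 ∧ v 2 = w 1 := by
  constructor
  · intro h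
    exact ⟨h 0 (by norm_num), h 1 (by norm_num)⟩
  · rintro ⟨h0, h1⟩ i hi
    have : i = 0 ∨ i = 1 := by omega
    rcases this with rfl | rfl
    · exact h0
    · exact h1

/-- `S` contains no two distinct adjacent nodes. -/
def IsIndep {n : ℕ} (S : Set (Word n)) : Prop :=
  ∀ v ∈ S, ∀ w ∈ S, v 1 = w 0 → v 2 = w 1 → v = w

lemma isIndepSet_iff {n : ℕ} (S : Set (Word n)) :
    (graph n 3).toSimpleGraphInclusive.IsIndepSet S ↔ IsIndep S := by
  unfold SimpleGraph.IsIndepSet Set.Pairwise IsIndep Digraph.toSimpleGraphInclusive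
  simp only [SimpleGraph.fromRel_adj, graph_adj]
  constructor
  · intro h v hv w hw h1 h2
    by_contra hne
    exact h hv hw hne ⟨hne, Or.inl ⟨h1, h2⟩⟩
  · rintro h v hv w hw hne ⟨-, h1 | h1⟩
    · exact hne (h v hv w hw h1.1 h1.2)
    · exact hne (h w hw v hv h1.1 h1.2).symm

lemma isMIS_iff_ncard {n : ℕ} (S : Set (Word n)) :
    IsMIS S ↔ IsIndep S ∧ ∀ S' : Set (Word n), IsIndep S' → S'.ncard ≤ S.ncard := by
  unfold IsMIS
  rw [SimpleGraph.isMaximumIndepSet_iff, Set.Finite.coe_toFinset, isIndepSet_iff]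
  refine and_congr_right fun _ => ⟨fun h S' hS' => ?_, fun h t ht => ?_⟩
  · have := h S'.toFinite.toFinset (by rwa [Set.Finite.coe_toFinset, isIndepSet_iff])
    rwa [← Set.ncard_eq_toFinset_card, ← Set.ncard_eq_toFinset_card] at this
  · rw [isIndepSet_iff] at ht
    have := h _ ht
    rwa [Set.ncard_coe_finset, Set.ncard_eq_toFinset_card S] at this

namespace Cfg

variable {n : ℕ} (c : Cfg n)

/-- Along an edge the last pair of one word is the first pair of the next. Tails, heads and loop
pairs exclude each other, so only a loop can follow a loop. -/
lemma isIndep_words : IsIndep c.words := by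
  intro v hv w hw h1 h2
  rw [word_eta v, word_eta w, word_eq]
  rcases hv with ⟨a1, a2, a3⟩ | ⟨a1, a2⟩ <;> rcases hw with ⟨b1, b2, b3⟩ | ⟨b1, b2⟩
  · grind
  · exact absurd (by rw [← h1, ← h2, ← a2, ← a1] at b1; exact b1) (c.loop _ a3)
  · exact absurd ⟨by rw [h1, h2, b1], by rw [h1]; exact b3⟩ a2.2
  · exact absurd (by rw [h1, h2]; exact b1) a2.1

/-- Take as tails only the pairs that begin a non-constant word of S; independence keeps them from
ending one. -/
lemma exists_subset_words {S : Set (Word n)} (hS : IsIndep S) : ∃ c : Cfg n, S ⊆ c.words := by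
  refine ⟨⟨({x | ![x, x, x] ∈ S} : Finset (Fin n)),
    fun x y => ∃ z, ![x, y, z] ∈ S ∧ ¬ (x = y ∧ y = z), ?_⟩, ?_⟩
  · rintro x hx ⟨z, hz, hne⟩
    simp only [mem_filter, mem_univ, true_and] at hx
    have := hS _ hx _ hz rfl rfl
    rw [word_eq] at this
    exact hne ⟨rfl, this.2.2⟩
  · intro w hw
    obtain ⟨x, y, z, rfl⟩ : ∃ x y z, w = ![x, y, z] := ⟨_, _, _, word_eta w⟩
    rw [mem_words]
    by_cases hc : x = y ∧ y = z
    · obtain ⟨rfl, rfl⟩ := hc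
      left
      simpa using hw
    · right
      refine ⟨⟨z, hw, hc⟩, ?_, ?_⟩
      · rintro ⟨u, hu, hne⟩
        obtain ⟨h1, h2, h3⟩ := word_eq.1 (hS _ hw _ hu rfl rfl)
        exact hc ⟨h1, h2⟩
      · rintro ⟨he, hx⟩
        simp only [mem_filter, mem_univ, true_and] at hx
        obtain ⟨h1, h2, h3⟩ := word_eq.1 (hS _ hw _ hx rfl he.symm)
        exact hc ⟨h1, he⟩

/-- Sort the words that are not loops by their middle digit. -/
lemma ncard_words : c.words.ncard = c.val := by
  let e₁ : Fin n → Word n := fun x => ![x, x, x]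
  let e₂ : (Σ _ : Fin n, Fin n × Fin n) → Word n := fun i => ![i.2.1, i.1, i.2.2]
  have h₁ : Function.Injective e₁ := fun x y h => (word_eq.1 h).1
  have h₂ : Function.Injective e₂ := by
    rintro ⟨y, x, z⟩ ⟨y', x', z'⟩ h
    obtain ⟨h1, h2, h3⟩ := word_eq.1 h
    simp_all
  have e : c.words = ↑(c.X.image e₁ ∪ (univ.sigma fun y =>
      ({x | c.T x y} : Finset (Fin n)) ×ˢ ({z | c.H y z} : Finset (Fin n))).image e₂) := by
    ext w
    obtain ⟨x, y, z, rfl⟩ : ∃ x y z, w = ![x, y, z] := ⟨_, _, _, word_eta w⟩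
    simp only [mem_words, coe_union, coe_image, Set.mem_union, Set.mem_image, Finset.mem_coe,
      mem_sigma, mem_univ, true_and, mem_product, mem_filter, e₁, e₂, word_eq, Sigma.exists,
      Prod.exists]
    constructor
    · rintro (⟨h1, h2, h3⟩ | h)
      · exact Or.inl ⟨_, h3, rfl, h1, h1.trans h2⟩
      · exact Or.inr ⟨_, _, _, h, rfl, rfl, rfl⟩
    · rintro (⟨x, h, h1, h2, h3⟩ | ⟨y, x, z, h, h1, h2, h3⟩)
      · exact Or.inl ⟨h1.symm.trans h2, h2.symm.trans h3, h1 ▸ h⟩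
      · subst h1 h2 h3
        exact Or.inr h
  rw [e, Set.ncard_coe_finset, card_union_of_disjoint, card_image_of_injective _ h₁,
    card_image_of_injective _ h₂, card_sigma]
  · simp [val, p, q]
  · rw [disjoint_left]
    intro w h1 h2
    simp only [mem_image, mem_sigma, mem_univ, true_and, mem_product, mem_filter] at h1 h2
    obtain ⟨x, hx, rfl⟩ := h1
    obtain ⟨⟨y, x', z⟩, h, h'⟩ := h2
    obtain ⟨h1, h2, h3⟩ := word_eq.1 h'
    simp only at h1 h2 h
    subst h1 h2
    exact c.loop _ hx h.1

end Cfg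

/-! ### The upper bound and its equality case -/

/-- The independence number of `B(n,3)` for `n > 0`. -/
def alpha (n : ℕ) : ℕ := 1 + ∑ i ∈ range n, i * (i + 1)

lemma alpha_succ (n : ℕ) : alpha (n + 1) = alpha n + n * (n + 1) := by
  simp [alpha, sum_range_succ, add_assoc]

/-- Layer-cake form (s-1) + (s-3) + ⋯ of ⌊s²/4⌋, with truncated subtraction; it allows summing over
digits before levels. -/
lemma sq_div_four (n : ℕ) : ∀ s ≤ 2 * n + 1, s ^ 2 / 4 = ∑ j ∈ range n, (s - (2 * j + 1)) := by
  induction n with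
  | zero => intro s hs; interval_cases s <;> simp
  | succ n ih =>
    intro s hs
    rcases s with _ | _ | s
    · simp
    · simp
    · rw [sum_range_succ']
      have h := ih s (by omega)
      have e : ∀ j, s + 1 + 1 - (2 * (j + 1) + 1) = s - (2 * j + 1) := fun j => by omega
      simp only [e, ← h]
      have : (s + 1 + 1) ^ 2 = s ^ 2 + 4 * (s + 1) := by ring
      rw [this, Nat.add_mul_div_left _ _ (by norm_num)]
      omega

lemma mul_le_sq_div_four (p q : ℕ) : p * q ≤ (p + q) ^ 2 / 4 := by
  rw [Nat.le_div_iff_mul_le (by norm_num)]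
  nlinarith [sq_nonneg ((p : ℤ) - q), four_mul_le_sq_add p q]

/-- The difference (p+q+1)² - 4pq = (p-q)² + 2(p+q) + 1 is at least 4 unless p = q = 0; that
exception is what `Cfg.isolated` corrects. -/
lemma mul_add_one_le_sq_div_four {p q : ℕ} (h : ¬ (p = 0 ∧ q = 0)) :
    p * q + 1 ≤ (p + q + 1) ^ 2 / 4 := by
  rw [Nat.le_div_iff_mul_le (by norm_num)]
  rcases Nat.lt_or_ge p q with hpq | hpq
  · obtain ⟨r, rfl⟩ := Nat.exists_eq_add_of_lt hpq
    nlinarith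
  · obtain ⟨r, rfl⟩ := Nat.exists_eq_add_of_le hpq
    rcases r with _ | r
    · have : 1 ≤ q := by omega
      nlinarith
    · nlinarith

/-- Equality forces (p-q)² + 2(p+q) + 1 < 8. -/
lemma le_one_of_mul_add_one_eq {p q : ℕ} (h : p * q + 1 = (p + q + 1) ^ 2 / 4) :
    p ≤ 1 ∧ q ≤ 1 := by
  have h' : (p + q + 1) ^ 2 < (p * q + 2) * 4 := by
    rw [← Nat.div_lt_iff_lt_mul (by norm_num)]; omega
  constructor
  · by_contra! hp
    obtain ⟨r, rfl⟩ := Nat.exists_eq_add_of_le hp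
    zify at h'
    nlinarith [sq_nonneg ((r : ℤ) + 1 - q)]
  · by_contra! hp
    obtain ⟨r, rfl⟩ := Nat.exists_eq_add_of_le hp
    zify at h'
    nlinarith [sq_nonneg ((r : ℤ) + 1 - p)]

lemma eq_of_mul_eq_sq_div_four {p q r : ℕ} (h : p * q = (p + q) ^ 2 / 4) (hr : p + q = 2 * r) :
    p = r ∧ q = r := by
  have h' : (p + q) ^ 2 < (p * q + 1) * 4 := by
    rw [← Nat.div_lt_iff_lt_mul (by norm_num)]; omega
  obtain ⟨x, hx⟩ : ∃ x : ℤ, (p : ℤ) = r + x := ⟨p - r, by ring⟩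
  have hq : (q : ℤ) = r - x := by zify at hr; linarith
  zify at h'
  rw [hx, hq] at h'
  have : x = 0 := by nlinarith
  omega

namespace Cfg

variable {n : ℕ} (c : Cfg n)

/-- The number of entries in row and column `y`, with the entry `yy` of a loop counted. -/
noncomputable def s (y : Fin n) : ℕ := c.p y + c.q y + if y ∈ c.X then 1 else 0

/-- The number of tails from outside into `Y` and of heads from `Y` to the outside. -/
noncomputable def exc (Y : Finset (Fin n)) : ℕ :=
  ∑ y ∈ Y, ∑ x ∈ Yᶜ, ((if c.T x y then 1 else 0) + if c.H y x then 1 else 0)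

lemma T_H_cases (x y : Fin n) : (if c.T x y then 1 else 0) + (if c.H x y then 1 else 0) +
    (if x = y ∧ y ∈ c.X then 1 else 0) = 1 := by
  by_cases hT : c.T x y
  · have : ¬ (x = y ∧ y ∈ c.X) := by rintro ⟨rfl, h⟩; exact c.loop _ h hT
    simp [hT, H, this]
  · by_cases h : x = y ∧ y ∈ c.X
    · have : ¬ c.H x y := fun hh => hh.2 ⟨h.1, h.1 ▸ h.2⟩
      rw [if_neg hT, if_neg this, if_pos h]
    · have : c.H x y := ⟨hT, fun h' => h ⟨h'.1, h'.1 ▸ h'.2⟩⟩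
      simp [hT, h, this]

lemma s_eq (y : Fin n) : c.s y = ∑ x, ((if c.T x y then 1 else 0) + (if c.H y x then 1 else 0) +
    (if x = y ∧ y ∈ c.X then 1 else 0)) := by
  rw [sum_add_distrib, sum_add_distrib, s, p, q, card_filter, card_filter]
  congr 1
  by_cases h : y ∈ c.X <;> simp [h]

/-- Count a tail at its second digit and a head at its first. By `T_H_cases` each of the |Y|² pairs
inside Y is counted once, and the pairs crossing the boundary give the excess. -/
lemma sum_s (Y : Finset (Fin n)) : ∑ y ∈ Y, c.s y = #Y ^ 2 + c.exc Y := by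
  have h1 : ∀ y ∈ Y, c.s y = (∑ x ∈ Y, ((if c.T x y then 1 else 0) + (if c.H y x then 1 else 0) +
      (if x = y ∧ y ∈ c.X then 1 else 0))) +
      ∑ x ∈ Yᶜ, ((if c.T x y then 1 else 0) + if c.H y x then 1 else 0) := by
    intro y hy
    rw [s_eq, ← sum_add_sum_compl Y]
    congr 1
    refine sum_congr rfl fun x hx => ?_
    have : x ≠ y := by rintro rfl; exact (mem_compl.1 hx) hy
    simp [this]
  rw [sum_congr rfl h1, sum_add_distrib, exc]
  congr 1
  have h2 : ∑ y ∈ Y, ∑ x ∈ Y, (if c.H y x then 1 else 0) =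
    ∑ y ∈ Y, ∑ x ∈ Y, (if c.H x y then 1 else 0) := sum_comm
  simp only [sum_add_distrib, h2]
  simp only [← sum_add_distrib, T_H_cases]
  simp [sq]

/-- All pairs from `Y` to the outside are tails, and all pairs from the outside into `Y` are not. -/
def Tight (Y : Finset (Fin n)) : Prop := ∀ y ∈ Y, ∀ x ∉ Y, c.T y x ∧ ¬ c.T x y

variable {c}

lemma tight_iff {Y : Finset (Fin n)} : c.Tight Y ↔ c.exc Y = 0 := by
  simp only [exc, sum_eq_zero_iff, Tight, mem_compl]
  refine forall₂_congr fun y hy => forall₂_congr fun x hx => ?_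
  have : y ≠ x := by rintro rfl; exact hx hy
  simp only [H, this, false_and, not_false_eq_true, and_true]
  by_cases h1 : c.T y x <;> by_cases h2 : c.T x y <;> simp [h1, h2]

lemma Tight.sum_s {Y : Finset (Fin n)} (h : c.Tight Y) : ∑ y ∈ Y, c.s y = #Y ^ 2 := by
  rw [c.sum_s, tight_iff.1 h, add_zero]

variable (c)

lemma sum_s_univ : ∑ y, c.s y = n ^ 2 := by
  rw [c.sum_s]; simp [exc]

/-- The digits `y` with `s y ≤ 2 j + 1`. -/
noncomputable def low (j : ℕ) : Finset (Fin n) := {y | c.s y ≤ 2 * j + 1}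

/-- Only digits outside `low j` contribute to the truncated sum, and `sum_s` evaluates their total
as n² - |low j|² minus the excess. -/
lemma sum_sub (j : ℕ) : ((∑ y, (c.s y - (2 * j + 1)) : ℕ) : ℤ) + ((#(c.low j) : ℤ) - j) *
    (#(c.low j) - j - 1) + c.exc (c.low j) = ((n : ℤ) - j) * (n - j - 1) := by
  have h1 : ((∑ y, (c.s y - (2 * j + 1)) : ℕ) : ℤ) =
      ∑ y ∈ (c.low j)ᶜ, ((c.s y : ℤ) - (2 * j + 1)) := by
    rw [← sum_add_sum_compl (c.low j)]
    have hz : ∑ y ∈ c.low j, (c.s y - (2 * j + 1)) = 0 :=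
      sum_eq_zero fun y hy => Nat.sub_eq_zero_of_le (mem_filter.1 hy).2
    rw [hz, zero_add, Nat.cast_sum]
    refine sum_congr rfl fun y hy => ?_
    have : 2 * j + 1 < c.s y := by simpa [low] using hy
    rw [Nat.cast_sub this.le]; push_cast; ring
  have h2 := c.sum_s_univ
  rw [← sum_add_sum_compl (c.low j), c.sum_s] at h2
  have h3 := card_add_card_compl (c.low j)
  rw [Fintype.card_fin] at h3
  rw [h1, sum_sub_distrib, sum_const, nsmul_eq_mul]
  zify at h2 h3
  have h4 : (#(c.low j)ᶜ : ℤ) = n - #(c.low j) := by linarith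
  rw [h4]
  linear_combination h2

/-- The digit `y` is a loop that occurs in no other word but in the middle. -/
noncomputable def isolated (y : Fin n) : ℕ := if y ∈ c.X ∧ c.p y = 0 ∧ c.q y = 0 then 1 else 0

/-- For distinct x and y the pair xy is a tail counted by p(y) or a head counted by q(x), so x and y
cannot both be isolated. -/
lemma sum_isolated_le : ∑ y, c.isolated y ≤ 1 := by
  unfold isolated
  rw [← card_filter, card_le_one]
  intro x hx y hy
  simp only [mem_filter, mem_univ, true_and] at hx hy
  by_contra hne
  by_cases h : c.T x y
  · have : x ∈ ({z | c.T z y} : Finset (Fin n)) := by simpa using h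
    rw [card_eq_zero.1 hy.2.1] at this
    simp at this
  · have : y ∈ ({z | c.H x z} : Finset (Fin n)) := by simpa [H, hne] using h
    rw [card_eq_zero.1 hx.2.2] at this
    simp at this

lemma weight_le (y : Fin n) : c.p y * c.q y + (if y ∈ c.X then 1 else 0) ≤
    c.s y ^ 2 / 4 + c.isolated y := by
  unfold s isolated
  by_cases hy : y ∈ c.X
  · by_cases h : c.p y = 0 ∧ c.q y = 0
    · simp [hy, h]
    · simpa [hy, h] using mul_add_one_le_sq_div_four h
  · simpa [hy] using mul_le_sq_div_four _ _

lemma s_le (y : Fin n) : c.s y ≤ 2 * n + 1 := by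
  have h1 : c.p y ≤ n := (card_le_univ _).trans_eq (Fintype.card_fin n)
  have h2 : c.q y ≤ n := (card_le_univ _).trans_eq (Fintype.card_fin n)
  unfold s
  split_ifs <;> omega

lemma sum_sq_div_four : ∑ y, c.s y ^ 2 / 4 = ∑ j ∈ range n, ∑ y, (c.s y - (2 * j + 1)) := by
  rw [sum_comm]
  exact sum_congr rfl fun y _ => sq_div_four n _ (c.s_le y)

lemma alpha_eq : (alpha n : ℤ) = 1 + ∑ j ∈ range n, ((n : ℤ) - j) * (n - j - 1) := by
  rw [alpha, ← sum_range_reflect]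
  push_cast
  congr 1
  refine sum_congr rfl fun j hj => ?_
  have : j < n := mem_range.1 hj
  rw [Nat.sub_sub, Nat.cast_sub (by omega)]
  push_cast
  ring

lemma val_eq : c.val = ∑ y, (c.p y * c.q y + if y ∈ c.X then 1 else 0) := by
  rw [val, sum_add_distrib, add_comm]
  simp

/-- A product of two consecutive integers. -/
lemma defect_nonneg (j : ℕ) : 0 ≤ ((#(c.low j) : ℤ) - j) * (#(c.low j) - j - 1) := by
  rcases le_or_gt (#(c.low j) : ℤ) j with h | h
  · nlinarith
  · have : (0 : ℤ) ≤ #(c.low j) - j - 1 := by omega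
    exact mul_nonneg (by omega) this

/-- The three groups measure the loss in the estimate for each digit, the loss at each level, and
the absence of an isolated loop. -/
lemma alpha_sub_val : (alpha n : ℤ) - c.val =
    (∑ y, ((c.s y ^ 2 / 4 + c.isolated y : ℕ) -
      (c.p y * c.q y + (if y ∈ c.X then 1 else 0) : ℕ) : ℤ)) +
    (∑ j ∈ range n, (((#(c.low j) : ℤ) - j) * (#(c.low j) - j - 1) + c.exc (c.low j))) +
    (1 - ∑ y, c.isolated y) := by
  rw [alpha_eq, val_eq, sum_congr rfl fun j _ => (c.sum_sub j).symm]
  have := c.sum_sq_div_four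
  zify at this
  simp only [sum_sub_distrib, Nat.cast_add, sum_add_distrib, Nat.cast_sum, add_assoc] at this ⊢
  push_cast at this ⊢
  rw [this]
  ring

lemma val_le_and : c.val ≤ alpha n ∧ (c.val = alpha n →
    (∀ y, c.p y * c.q y + (if y ∈ c.X then 1 else 0) = c.s y ^ 2 / 4 + c.isolated y) ∧
    (∀ j < n, (#(c.low j) = j ∨ #(c.low j) = j + 1) ∧ c.Tight (c.low j)) ∧
    ∃ y, c.isolated y = 1) := by
  have h := c.alpha_sub_val
  have h1 : ∀ y ∈ univ, (0 : ℤ) ≤ ((c.s y ^ 2 / 4 + c.isolated y : ℕ) -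
      (c.p y * c.q y + (if y ∈ c.X then 1 else 0) : ℕ) : ℤ) := fun y _ => by
    have := c.weight_le y; omega
  have h2 : ∀ j ∈ range n, (0 : ℤ) ≤
      (((#(c.low j) : ℤ) - j) * (#(c.low j) - j - 1) + c.exc (c.low j)) := fun j _ =>
    add_nonneg (c.defect_nonneg j) (Nat.cast_nonneg _)
  have h3 := c.sum_isolated_le
  have h1' := sum_nonneg h1
  have h2' := sum_nonneg h2
  have h3 : ((∑ y, c.isolated y : ℕ) : ℤ) ≤ 1 := by exact_mod_cast h3
  refine ⟨by zify; linarith, fun hv => ?_⟩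
  rw [hv, sub_self] at h
  refine ⟨fun y => ?_, fun j hj => ?_, ?_⟩
  · have := (sum_eq_zero_iff_of_nonneg h1).1 (by linarith) y (mem_univ _)
    omega
  · have := (sum_eq_zero_iff_of_nonneg h2).1 (by linarith) j (mem_range.2 hj)
    have hd := c.defect_nonneg j
    have he : (0 : ℤ) ≤ c.exc (c.low j) := Nat.cast_nonneg _
    refine ⟨?_, ?_⟩
    · have : ((#(c.low j) : ℤ) - j) * (#(c.low j) - j - 1) = 0 := by linarith
      rcases mul_eq_zero.1 this with h0 | h0 <;> omega
    · rw [tight_iff]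
      omega
  · have hs : ((∑ y, c.isolated y : ℕ) : ℤ) = 1 := by linarith
    by_contra! hne
    have : ∑ y, c.isolated y = 0 := sum_eq_zero fun y _ => by
      have := hne y
      unfold isolated at this ⊢
      split_ifs at this ⊢ with h
      · exact absurd rfl this
      · rfl
    omega

end Cfg

/-! ### Structure of optimal configurations -/

/-- The relation that the tails form on the digits added by an operation. -/
def pairRel {α : Type*} (b : Bool) (y z : α) : Prop := if b then y = z else y ≠ z

namespace Cfg

variable {n : ℕ} {c : Cfg n}

lemma low_mono {i j : ℕ} (h : i ≤ j) : c.low i ⊆ c.low j := fun y hy => by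
  simp only [low, mem_filter, mem_univ, true_and] at hy ⊢
  omega

/-- This is the isolated loop; it will be the distinguished loop. -/
lemma exists_source (h : c.val = alpha n) : ∃ a ∈ c.X, ∀ x ≠ a, c.T a x ∧ ¬ c.T x a := by
  obtain ⟨a, ha⟩ := (c.val_le_and.2 h).2.2
  have ha : a ∈ c.X ∧ c.p a = 0 ∧ c.q a = 0 := by
    by_contra hne
    simp [isolated, hne] at ha
  refine ⟨a, ha.1, fun x hx => ⟨?_, ?_⟩⟩
  · have := filter_eq_empty_iff.1 (card_eq_zero.1 ha.2.2) (mem_univ x)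
    simpa [H, hx.symm] using this
  · exact filter_eq_empty_iff.1 (card_eq_zero.1 ha.2.1) (mem_univ x)

/-- The source has s = 1, and equality in the weight estimate gives s ≤ 3 for any other loop. So two
or more loops all lie in `low 1`, which has at most two elements. -/
lemma low_card_loops (h : c.val = alpha n) :
    c.low (#c.X - 1) = c.X ∧ (#c.X = 1 ∨ #c.X = 2) := by
  obtain ⟨hw, hl, -⟩ := c.val_le_and.2 h
  obtain ⟨a, haX, ha⟩ := exists_source h
  have hsa : c.s a = 1 := by
    have hp : c.p a = 0 := card_eq_zero.2 <| filter_eq_empty_iff.2 fun x _ => by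
      by_cases hx : x = a
      · subst hx; exact c.loop _ haX
      · exact (ha x hx).2
    have hq : c.q a = 0 := card_eq_zero.2 <| filter_eq_empty_iff.2 fun x _ hH => by
      by_cases hx : x = a
      · subst hx; exact hH.2 ⟨rfl, haX⟩
      · exact hH.1 (ha x hx).1
    simp [s, hp, hq, haX]
  by_cases hX : c.X = {a}
  · have h0 := (hl 0 a.pos).1
    have : a ∈ c.low 0 := by simp [low, hsa]
    have hc : #c.X = 1 := by simp [hX]
    refine ⟨?_, Or.inl hc⟩
    rw [hc, hX, eq_comm]
    exact eq_of_subset_of_card_le (singleton_subset_iff.2 this) (by simp; omega)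
  · obtain ⟨b, hb, hba⟩ : ∃ b ∈ c.X, b ≠ a := by
      by_contra! hne
      exact hX (eq_singleton_iff_unique_mem.2 ⟨haX, hne⟩)
    have hsub : c.X ⊆ c.low 1 := fun x hx => by
      simp only [low, mem_filter, mem_univ, true_and]
      by_cases hxa : x = a
      · rw [hxa, hsa]; norm_num
      · have hpx : c.p x ≠ 0 := fun h0 =>
          filter_eq_empty_iff.1 (card_eq_zero.1 h0) (mem_univ a) (ha x hxa).1
        have := hw x
        simp only [hx, if_true, isolated, hpx, false_and, and_false, if_false, add_zero, s] at this
        have := le_one_of_mul_add_one_eq this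
        simp only [s, hx, if_true]
        omega
    have h2 : 2 ≤ #c.X := by
      rw [← card_pair hba]
      exact card_le_card (by simp [insert_subset_iff, hb, haX])
    have hn : 1 < n := by
      have := card_le_univ c.X
      rw [Fintype.card_fin] at this
      omega
    have h1 := (hl 1 hn).1
    have h3 := card_le_card hsub
    have h4 : #c.X = 2 := by omega
    refine ⟨?_, Or.inr h4⟩
    rw [h4, eq_comm]
    exact eq_of_subset_of_card_le hsub (by change #(c.low 1) ≤ _; omega)

lemma tight_loops (h : c.val = alpha n) : c.Tight c.X := by
  obtain ⟨h1, h2⟩ := low_card_loops h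
  have := card_le_univ c.X
  rw [Fintype.card_fin] at this
  rw [← h1]
  exact ((c.val_le_and.2 h).2.1 _ (by omega)).2

/-- The number of tails into and of heads from a digit of the layer above the loops. -/
lemma p_q_of_tight {N : Finset (Fin n)} (hX : c.Tight c.X) (hN : Disjoint c.X N)
    (hXN : c.Tight (c.X ∪ N)) {y : Fin n} (hy : y ∈ N) :
    c.p y = #c.X + #{x ∈ N | c.T x y} ∧ c.q y = #c.X + #{z ∈ N | ¬ c.T y z} := by
  have hyX : y ∉ c.X := fun h => disjoint_left.1 hN h hy
  have hyXN : y ∈ c.X ∪ N := mem_union_right _ hy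
  constructor
  · rw [← card_union_of_disjoint (disjoint_of_subset_right (filter_subset _ _) hN), p]
    congr 1
    ext x
    simp only [mem_filter, mem_univ, true_and, mem_union]
    by_cases hx : x ∈ c.X
    · simp [hx, (hX x hx y hyX).1]
    · by_cases hxN : x ∈ N
      · simp [hx, hxN]
      · simp [hx, hxN, (hXN y hyXN x (by simp [hx, hxN])).2]
  · rw [← card_union_of_disjoint (disjoint_of_subset_right (filter_subset _ _) hN), q]
    congr 1
    ext x
    simp only [mem_filter, mem_univ, true_and, mem_union]
    by_cases hx : x ∈ c.X
    · have : y ≠ x := by rintro rfl; exact hyX hx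
      simp [H, hx, (hX x hx y hyX).2, this]
    · by_cases hxN : x ∈ N
      · simp [H, hx, hxN, hyX]
      · simp [H, hx, hxN, (hXN y hyXN x (by simp [hx, hxN])).1]

lemma ite_add_ite_eq_one {P Q : Prop} [Decidable P] [Decidable Q]
    (h : (if P then 1 else 0) + (if Q then 1 else 0) = 1) : P ↔ ¬ Q := by
  by_cases hP : P <;> by_cases hQ : Q <;> simp [hP, hQ] at h ⊢

/-- The hypotheses make the 2 × 2 matrix of R alternate, so it is the diagonal or its complement. -/
lemma pairRel_of_pair {α : Type*} [DecidableEq α] {y z : α} (hyz : y ≠ z) {R : α → α → Prop}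
    (e1 : R y y ↔ ¬ R z y) (e2 : ¬ R y y ↔ ¬ ¬ R y z) (e3 : ¬ R z y ↔ ¬ ¬ R z z) :
    ∀ u ∈ ({y, z} : Finset α), ∀ v ∈ ({y, z} : Finset α),
      R u v ↔ pairRel (decide (R y y)) u v := by
  simp only [mem_insert, mem_singleton, forall_eq_or_imp, forall_eq, pairRel]
  have h1 : R z y ↔ ¬ R y y := by tauto
  have h2 : R y z ↔ ¬ R y y := by tauto
  have h3 : R z z ↔ R y y := by tauto
  by_cases h : R y y <;> simp [h1, h2, h3, h, hyz, hyz.symm]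

/-- At level |X| the level set either gains one digit, which is the layer, or equals X. In the
second case the next level set gains two digits, and their s-values are forced. -/
lemma exists_layer (h : c.val = alpha n) (hn : #c.X < n) : ∃ (N : Finset (Fin n)) (b : Bool),
    (#N = 1 ∨ #N = 2) ∧ Disjoint c.X N ∧ c.Tight (c.X ∪ N) ∧
    ∀ y ∈ N, ∀ z ∈ N, c.T y z ↔ pairRel b y z := by
  obtain ⟨hw, hl, -⟩ := c.val_le_and.2 h
  obtain ⟨hlow, hcard⟩ := low_card_loops h
  have htX := tight_loops h
  have hsub : ∀ j, #c.X - 1 ≤ j → c.X ⊆ c.low j := fun j hj => by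
    conv_lhs => rw [← hlow]
    exact low_mono hj
  have hsum : ∀ Y, c.X ⊆ Y → c.Tight Y → ∑ y ∈ Y \ c.X, c.s y + #c.X ^ 2 = #Y ^ 2 := by
    intro Y hY ht
    rw [← ht.sum_s, ← htX.sum_s, sum_sdiff hY]
  rcases (hl _ hn).1 with hk | hk
  · have hX : c.X = c.low #c.X := eq_of_subset_of_card_le (hsub _ (by omega)) hk.le
    have hlarge : ∀ y ∉ c.X, 2 * #c.X + 2 ≤ c.s y := fun y hy => by
      rw [hX] at hy
      simp only [low, mem_filter, mem_univ, true_and] at hy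
      omega
    -- A single extra digit would have s = (|X|+1)² - |X|² = 2|X| + 1, below the bound `hlarge`.
    have hno : ∀ Y, c.X ⊆ Y → c.Tight Y → #Y ≠ #c.X + 1 := by
      intro Y hY ht hc
      obtain ⟨y, hy⟩ := card_eq_one.1 (show #(Y \ c.X) = 1 by rw [card_sdiff_of_subset hY]; omega)
      have h1 := hsum Y hY ht
      have h2 := hlarge y (mem_sdiff.1 (hy ▸ mem_singleton_self y)).2
      rw [hy, sum_singleton, hc] at h1
      nlinarith
    have hn' : #c.X + 1 < n := by
      have := hno univ (subset_univ _) (fun y _ x hx => absurd (mem_univ x) hx)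
      rw [card_univ, Fintype.card_fin] at this
      omega
    obtain ⟨hk', ht⟩ := hl _ hn'
    have hY := hsub (#c.X + 1) (by omega)
    have hk' := hk'.resolve_left (hno _ hY ht)
    obtain ⟨y, z, hyz, hN⟩ := card_eq_two.1 (show #(c.low (#c.X + 1) \ c.X) = 2 by
      rw [card_sdiff_of_subset hY]; omega)
    have hdis : Disjoint c.X ({y, z} : Finset (Fin n)) := hN ▸ disjoint_sdiff
    have hun : c.X ∪ {y, z} = c.low (#c.X + 1) := by rw [← hN, union_sdiff_of_subset hY]
    have hyX : y ∉ c.X := fun h => disjoint_left.1 hdis h (by simp)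
    have hzX : z ∉ c.X := fun h => disjoint_left.1 hdis h (by simp)
    have h1 := hsum _ hY ht
    rw [hN, sum_pair hyz, hk'] at h1
    have h2 := hlarge y hyX
    have h3 := hlarge z hzX
    have h4 : (#c.X + 1 + 1) ^ 2 = #c.X ^ 2 + (4 * #c.X + 4) := by ring
    -- The two s-values add up to 4|X| + 4 and each is at least 2|X| + 2. So both are this even
    -- number, and an optimal product of two factors with even sum has equal factors.
    have hpq : ∀ u, u ∉ c.X → c.s u = 2 * (#c.X + 1) → c.p u = #c.X + 1 ∧ c.q u = #c.X + 1 := by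
      intro u hu hs
      have h5 := hw u
      simp only [isolated, hu, false_and, if_false, add_zero] at h5
      simp only [s, hu, if_false, add_zero] at hs h5
      exact eq_of_mul_eq_sq_div_four h5 hs
    have hpy := hpq y hyX (by omega)
    have hpz := hpq z hzX (by omega)
    rw [← hun] at ht
    have hy' := p_q_of_tight htX hdis ht (y := y) (by simp)
    have hz' := p_q_of_tight htX hdis ht (y := z) (by simp)
    simp only [card_filter, sum_pair hyz] at hy' hz'
    refine ⟨{y, z}, decide (c.T y y), Or.inr (card_pair hyz), hdis, ht, ?_⟩
    rw [hpy.1, hpy.2] at hy'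
    rw [hpz.1, hpz.2] at hz'
    have e1 := ite_add_ite_eq_one (Nat.add_left_cancel hy'.1).symm
    have e2 := ite_add_ite_eq_one (Nat.add_left_cancel hy'.2).symm
    have e3 := ite_add_ite_eq_one (Nat.add_left_cancel hz'.2).symm
    exact pairRel_of_pair hyz e1 e2 e3
  · have hY := hsub #c.X (by omega)
    obtain ⟨y, hN⟩ := card_eq_one.1 (show #(c.low #c.X \ c.X) = 1 by
      rw [card_sdiff_of_subset hY]; omega)
    refine ⟨{y}, decide (c.T y y), by simp, hN ▸ disjoint_sdiff, ?_, ?_⟩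
    · rw [← hN, union_sdiff_of_subset hY]
      exact (hl _ hn).2
    · by_cases hh : c.T y y <;> simp [pairRel, hh]

end Cfg

/-! ### Inserting a layer above the loops -/

namespace Cfg

variable {n : ℕ} (c : Cfg n)

/-- The configuration that arises when a layer of `ν` digits is inserted above the loops. -/
def ext (ν : ℕ) (b : Bool) : Cfg (n + ν) where
  X := c.X.map (Fin.castAddEmb ν)
  T x y := Fin.addCases
    (fun x => Fin.addCases (fun y => c.T x y) (fun _ => x ∈ c.X) y)
    (fun x => Fin.addCases (fun y => y ∉ c.X) (fun y => pairRel b x y) y) x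
  loop x hx := by
    obtain ⟨z, hz, rfl⟩ := mem_map.1 hx
    simpa using c.loop z hz

variable (ν : ℕ) (b : Bool) (x y : Fin n) (i j : Fin ν)

@[simp] lemma ext_T_old_old : (c.ext ν b).T (Fin.castAdd ν x) (Fin.castAdd ν y) ↔ c.T x y := by
  simp [ext]

@[simp] lemma ext_T_old_new : (c.ext ν b).T (Fin.castAdd ν x) (Fin.natAdd n j) ↔ x ∈ c.X := by
  simp [ext]

@[simp] lemma ext_T_new_old : (c.ext ν b).T (Fin.natAdd n i) (Fin.castAdd ν y) ↔ y ∉ c.X := by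
  simp [ext]

@[simp] lemma ext_T_new_new :
    (c.ext ν b).T (Fin.natAdd n i) (Fin.natAdd n j) ↔ pairRel b i j := by
  simp [ext]

@[simp] lemma ext_old_mem : Fin.castAdd ν x ∈ (c.ext ν b).X ↔ x ∈ c.X := by
  simp [ext]

@[simp] lemma ext_new_mem : Fin.natAdd n i ∉ (c.ext ν b).X := by
  intro h
  obtain ⟨x, -, hx⟩ := mem_map.1 h
  have := congrArg Fin.val hx
  simp at this
  omega

lemma castAdd_ne_natAdd {n ν : ℕ} (x : Fin n) (i : Fin ν) : Fin.castAdd ν x ≠ Fin.natAdd n i := by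
  intro h
  have := congrArg Fin.val h
  simp at this
  omega

@[simp] lemma ext_H_old_old : (c.ext ν b).H (Fin.castAdd ν x) (Fin.castAdd ν y) ↔ c.H x y := by
  simp [H]

@[simp] lemma ext_H_old_new : (c.ext ν b).H (Fin.castAdd ν x) (Fin.natAdd n j) ↔ x ∉ c.X := by
  simp [H, castAdd_ne_natAdd]

@[simp] lemma ext_H_new_old : (c.ext ν b).H (Fin.natAdd n i) (Fin.castAdd ν y) ↔ y ∈ c.X := by
  simp [H]

@[simp] lemma ext_H_new_new :
    (c.ext ν b).H (Fin.natAdd n i) (Fin.natAdd n j) ↔ ¬ pairRel b i j := by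
  simp [H]

lemma card_ext_X : #(c.ext ν b).X = #c.X := card_map _

lemma ext_p_old : (c.ext ν b).p (Fin.castAdd ν y) = c.p y + if y ∈ c.X then 0 else ν := by
  rw [p, p, card_filter, card_filter, Fin.sum_univ_add]
  by_cases h : y ∈ c.X <;> simp [h]

lemma ext_q_old : (c.ext ν b).q (Fin.castAdd ν y) = c.q y + if y ∈ c.X then 0 else ν := by
  rw [q, q, card_filter, card_filter, Fin.sum_univ_add]
  by_cases h : y ∈ c.X <;> simp [h]

lemma ext_p_new : (c.ext ν b).p (Fin.natAdd n j) = #c.X + #{i : Fin ν | pairRel b i j} := by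
  rw [p, card_filter, card_filter, Fin.sum_univ_add]
  simp

lemma ext_q_new : (c.ext ν b).q (Fin.natAdd n i) = #c.X + #{j : Fin ν | ¬ pairRel b i j} := by
  rw [q, card_filter, card_filter, Fin.sum_univ_add]
  simp

variable {c}

/-- For an old non-loop pq becomes (p+ν)(q+ν), while old loops keep p and q. Tightness gives n² -
|X|² as the sum of p + q over the non-loops. -/
lemma Tight.val_ext (h : c.Tight c.X) : (c.ext ν b).val + ν * #c.X ^ 2 + ν ^ 2 * #c.X =
    c.val + ν * n ^ 2 + ν ^ 2 * n + ∑ i : Fin ν,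
      (#c.X + #{j : Fin ν | pairRel b j i}) * (#c.X + #{j : Fin ν | ¬ pairRel b i j}) := by
  have h1 := c.sum_s_univ
  rw [← sum_add_sum_compl c.X, h.sum_s] at h1
  have h2 : ∑ y ∈ c.Xᶜ, c.s y = ∑ y ∈ c.Xᶜ, (c.p y + c.q y) :=
    sum_congr rfl fun y hy => by simp [s, mem_compl.1 hy]
  have h3 := card_add_card_compl c.X
  rw [Fintype.card_fin] at h3
  rw [h2] at h1
  have h4 : ∑ y, (c.ext ν b).p (Fin.castAdd ν y) * (c.ext ν b).q (Fin.castAdd ν y) =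
      ∑ y, c.p y * c.q y + (ν * ∑ y ∈ c.Xᶜ, (c.p y + c.q y) + ν ^ 2 * #c.Xᶜ) := by
    rw [← sum_add_sum_compl c.X, ← sum_add_sum_compl c.X (fun y => c.p y * c.q y), add_assoc]
    congr 1
    · exact sum_congr rfl fun y hy => by simp [ext_p_old, ext_q_old, hy]
    · rw [card_eq_sum_ones, mul_sum, mul_sum, ← sum_add_distrib, ← sum_add_distrib]
      refine sum_congr rfl fun y hy => ?_
      simp only [ext_p_old, ext_q_old, mem_compl.1 hy, if_false]
      ring
  rw [val, val, card_ext_X, Fin.sum_univ_add, h4]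
  simp only [ext_p_new, ext_q_new]
  rw [← h1]
  have h5 : ν ^ 2 * n = ν ^ 2 * #c.X + ν ^ 2 * #c.Xᶜ := by rw [← mul_add, h3]
  rw [h5]
  ring

/-- The terms in |X| cancel, so inserting a layer preserves the distance from the optimum; this is
used in both directions. -/
lemma Tight.val_ext_add (h : c.Tight c.X) (hν : ν = 1 ∨ ν = 2) :
    (c.ext ν b).val + alpha n = c.val + alpha (n + ν) := by
  have := h.val_ext ν b
  rcases hν with rfl | rfl
  · rw [alpha_succ]
    simp only [Fin.sum_univ_succ, card_filter] at this
    cases b <;> simp [pairRel] at this <;> nlinarith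
  · rw [alpha_succ, alpha_succ]
    simp only [Fin.sum_univ_succ, card_filter] at this
    cases b <;> simp [pairRel] at this <;> nlinarith

end Cfg

/-! ### Distinguished loops, and MISs as optimal configurations -/

lemma Cfg.isDistinguished_iff {n : ℕ} {c : Cfg n} {a : Fin n} :
    IsDistinguished c.words a ↔ a ∈ c.X ∧ ∀ x ≠ a, c.T a x ∧ ¬ c.T x a := by
  rw [IsDistinguished, c.mem_loops, m, Set.ncard_eq_zero]
  refine and_congr_right fun ha => ?_
  simp only [Set.eq_empty_iff_forall_notMem, missing, Set.mem_ofPred_eq, not_not, c.mem_words, Cfg.H]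
  refine ⟨fun h x hx => ?_, fun h x => ?_⟩
  · have := h x
    tauto
  · by_cases hx : x = a
    · subst hx; exact Or.inl ⟨rfl, rfl, ha⟩
    · exact Or.inr ⟨(h x hx).1, (h x hx).2, fun h' => hx h'.1⟩

lemma Cfg.exists_isDistinguished {n : ℕ} {c : Cfg n} (h : c.val = alpha n) :
    ∃ a, IsDistinguished c.words a := by
  obtain ⟨a, ha⟩ := Cfg.exists_source h
  exact ⟨a, Cfg.isDistinguished_iff.2 ha⟩

/-- For two distinguished loops the pair aa' would have to be a tail and not a tail. -/
lemma Cfg.isDistinguished_unique {n : ℕ} {c : Cfg n} {a a' : Fin n}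
    (h : IsDistinguished c.words a) (h' : IsDistinguished c.words a') : a' = a := by
  rw [Cfg.isDistinguished_iff] at h h'
  by_contra hne
  exact (h'.2 a (Ne.symm hne)).2 (h.2 a' hne).1

lemma exists_val_eq_alpha {n : ℕ} (hn : 0 < n) : ∃ c : Cfg n, c.val = alpha n := by
  induction n, hn using Nat.le_induction with
  | base =>
    refine ⟨⟨univ, fun _ _ => False, fun _ _ h => h⟩, ?_⟩
    simp [Cfg.val, alpha, Cfg.p]
  | succ n hn ih =>
    obtain ⟨c, hc⟩ := ih
    have := (Cfg.tight_loops hc).val_ext_add 1 false (Or.inl rfl)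
    exact ⟨c.ext 1 false, by omega⟩

theorem isMIS_iff {n : ℕ} (hn : 0 < n) {S : Set (Word n)} :
    IsMIS S ↔ ∃ c : Cfg n, c.words = S ∧ c.val = alpha n := by
  rw [isMIS_iff_ncard]
  constructor
  · rintro ⟨hS, hmax⟩
    obtain ⟨c, hc⟩ := Cfg.exists_subset_words hS
    obtain ⟨c', hc'⟩ := exists_val_eq_alpha hn
    have h1 := hmax _ c.isIndep_words
    have h2 := hmax _ c'.isIndep_words
    have h3 := Set.eq_of_subset_of_ncard_le hc h1
    refine ⟨c, h3.symm, le_antisymm c.val_le_and.1 ?_⟩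
    rw [c'.ncard_words, hc', h3, c.ncard_words] at h2
    exact h2
  · rintro ⟨c, rfl, hc⟩
    refine ⟨c.isIndep_words, fun S' hS' => ?_⟩
    obtain ⟨c', hc'⟩ := Cfg.exists_subset_words hS'
    calc S'.ncard ≤ c'.words.ncard := Set.ncard_le_ncard hc'
      _ ≤ c.words.ncard := by
        rw [c.ncard_words, c'.ncard_words, hc]
        exact c'.val_le_and.1

/-! ### The four operations as insertions -/

/-- The primed operations. -/
def Op.primed : Op → Bool
  | .f => false
  | .f' => true
  | .g => false
  | .g' => true

lemma Op.deg_eq (o : Op) : o.deg = 1 ∨ o.deg = 2 := by cases o <;> simp [Op.deg]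

lemma Op.ext_iff {o o' : Op} : o = o' ↔ o.deg = o'.deg ∧ o.primed = o'.primed := by
  cases o <;> cases o' <;> simp [Op.deg, Op.primed]

lemma new_eq (d : ℕ) : new d = Fin.natAdd d (0 : Fin 1) := rfl

lemma natAdd_ne_castAdd {n ν : ℕ} (x : Fin n) (i : Fin ν) : Fin.natAdd n i ≠ Fin.castAdd ν x :=
  (Cfg.castAdd_ne_natAdd x i).symm

lemma castAdd_eq_iff {n ν : ℕ} {x y : Fin n} : Fin.castAdd ν x = Fin.castAdd ν y ↔ x = y :=
  (Fin.castAdd_injective n ν).eq_iff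

lemma natAdd_eq_iff {n ν : ℕ} {x y : Fin ν} : Fin.natAdd n x = Fin.natAdd n y ↔ x = y :=
  (Fin.natAdd_injective ν n).eq_iff

lemma upWord_eq {d ν : ℕ} (x y z : Fin d) :
    upWord ν ![x, y, z] = ![Fin.castAdd ν x, Fin.castAdd ν y, Fin.castAdd ν z] := by
  ext i; fin_cases i <;> rfl

lemma mem_upWord_image {d ν : ℕ} {S : Set (Word d)} {v : Word (d + ν)} : v ∈ upWord ν '' S ↔
    ∃ x y z, ![x, y, z] ∈ S ∧ v = ![Fin.castAdd ν x, Fin.castAdd ν y, Fin.castAdd ν z] := by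
  constructor
  · rintro ⟨w, hw, rfl⟩
    exact ⟨w 0, w 1, w 2, by rwa [← word_eta], by rw [← upWord_eq, ← word_eta]⟩
  · rintro ⟨x, y, z, h, rfl⟩
    exact ⟨_, h, upWord_eq x y z⟩

lemma repl_eq {d : ℕ} (x y z a b : Fin d) : repl ![x, y, z] a b =
    ![if x = a then b else x, if y = a then b else y, if z = a then b else z] := by
  ext i; fin_cases i <;> rfl

/-- The digit a can occur first, last, or in both places. With at most two loops, excluding aba for
the other loop b leaves only non-loops next to the new digit. -/
lemma mem_replSet {d : ℕ} {c : Cfg d} {a : Fin d} (ha : IsDistinguished c.words a)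
    (hX : c.Tight c.X) (hcard : #c.X ≤ 2) {ν : ℕ} {y : Fin (d + ν)} {v : Word (d + ν)} :
    v ∈ replSet ν c.words a y ↔
    (∃ x z, x ∉ c.X ∧ z ≠ a ∧ c.H x z ∧ v = ![y, Fin.castAdd ν x, Fin.castAdd ν z]) ∨
    (∃ x z, x ≠ a ∧ z ∉ c.X ∧ c.T x z ∧ v = ![Fin.castAdd ν x, Fin.castAdd ν z, y]) ∨
    (∃ x, x ∉ c.X ∧ v = ![y, Fin.castAdd ν x, y]) := by
  rw [Cfg.isDistinguished_iff] at ha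
  obtain ⟨haX, ha⟩ := ha
  have hne : ∀ {x}, x ∉ c.X → x ≠ a := fun hx h => hx (h ▸ haX)
  have htwo : ∀ u ∈ c.X, u ≠ a → ∀ v ∈ c.X, v ≠ a → u = v := by
    intro u hu hua v hv hva
    by_contra huv
    have := card_le_card (show {a, u, v} ⊆ c.X by simp [insert_subset_iff, haX, hu, hv])
    rw [card_eq_three.2 ⟨a, u, v, hua.symm, hva.symm, huv, rfl⟩] at this
    omega
  constructor
  · rintro ⟨w, hw, ⟨i, hi⟩, h1, h2, rfl⟩
    obtain ⟨x, y, z, rfl⟩ : ∃ x y z, w = ![x, y, z] := ⟨_, _, _, word_eta w⟩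
    rw [upWord_eq, repl_eq]
    simp only [castAdd_eq_iff, up]
    rcases c.mem_words.1 hw with ⟨rfl, rfl, h⟩ | ⟨hT, hH⟩
    · exfalso
      fin_cases i <;> exact h1 (by simp at hi; simp [hi])
    -- No head begins with a, so a is not the middle digit.
    · have hya : y ≠ a := by
        rintro rfl
        by_cases hz : z = y
        · subst hz; exact hH.2 ⟨rfl, haX⟩
        · exact hH.1 (ha z hz).1
      by_cases hx : x = a
      · subst hx
        have hyX : y ∉ c.X := by
          intro hyX
          by_cases hz : z = x
          · subst hz; exact h2 y (c.mem_loops.2 hyX) hya rfl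
          · by_cases hzX : z ∈ c.X
            · exact hH.2 ⟨htwo y hyX hya z hzX hz, hyX⟩
            · exact hH.1 (hX y hyX z hzX).1
        by_cases hz : z = x
        · subst hz
          right; right
          exact ⟨y, hyX, by simp [hya]⟩
        · left
          exact ⟨y, z, hyX, hz, hH, by simp [hya, hz]⟩
      · have hz : z = a := by
          fin_cases i
          · exact absurd hi hx
          · exact absurd hi hya
          · exact hi
        subst hz
        right; left
        refine ⟨x, y, hx, fun hyX => ?_, hT, by simp [hya, hx]⟩
        by_cases hxX : x ∈ c.X
        · have := htwo x hxX hx y hyX hya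
          subst this
          exact c.loop _ hyX hT
        · exact (hX y hyX x hxX).2 hT
  · rintro (⟨x, z, hx, hz, hH, rfl⟩ | ⟨x, z, hx, hz, hT, rfl⟩ | ⟨x, hx, rfl⟩)
    · refine ⟨![a, x, z], c.mem_words.2 (Or.inr ⟨(ha x (hne hx)).1, hH⟩), ⟨0, rfl⟩, ?_, ?_, ?_⟩
      · rw [Ne, word_eq]; tauto
      · intro b hb hba
        rw [Ne, word_eq]; tauto
      · rw [upWord_eq, repl_eq]
        simp [hz, hne hx]
    · refine ⟨![x, z, a], c.mem_words.2 (Or.inr ⟨hT, (ha z (hne hz)).2, fun h => hne hz h.1⟩),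
        ⟨2, rfl⟩, ?_, ?_, ?_⟩
      · rw [Ne, word_eq]; tauto
      · intro b hb hba
        rw [Ne, word_eq]; tauto
      · rw [upWord_eq, repl_eq]
        simp [hx, hne hz]
    · refine ⟨![a, x, a], c.mem_words.2 (Or.inr ⟨(ha x (hne hx)).1, (ha x (hne hx)).2,
        fun h => hne hx h.1⟩), ⟨0, rfl⟩, ?_, ?_, ?_⟩
      · rw [Ne, word_eq]
        have := hne hx
        tauto
      · intro b hb hba
        rw [c.mem_loops] at hb
        rw [Ne, word_eq]
        rintro ⟨-, rfl, -⟩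
        exact hx hb
      · rw [upWord_eq, repl_eq]
        simp [hne hx]

lemma fin_add_cases {d ν : ℕ} {P : Word (d + ν) → Prop}
    (h000 : ∀ x y z : Fin d, P ![Fin.castAdd ν x, Fin.castAdd ν y, Fin.castAdd ν z])
    (h001 : ∀ (x y : Fin d) (k : Fin ν), P ![Fin.castAdd ν x, Fin.castAdd ν y, Fin.natAdd d k])
    (h010 : ∀ (x z : Fin d) (j : Fin ν), P ![Fin.castAdd ν x, Fin.natAdd d j, Fin.castAdd ν z])
    (h100 : ∀ (y z : Fin d) (i : Fin ν), P ![Fin.natAdd d i, Fin.castAdd ν y, Fin.castAdd ν z])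
    (h011 : ∀ (x : Fin d) (j k : Fin ν), P ![Fin.castAdd ν x, Fin.natAdd d j, Fin.natAdd d k])
    (h101 : ∀ (y : Fin d) (i k : Fin ν), P ![Fin.natAdd d i, Fin.castAdd ν y, Fin.natAdd d k])
    (h110 : ∀ (z : Fin d) (i j : Fin ν), P ![Fin.natAdd d i, Fin.natAdd d j, Fin.castAdd ν z])
    (h111 : ∀ i j k : Fin ν, P ![Fin.natAdd d i, Fin.natAdd d j, Fin.natAdd d k])
    (w : Word (d + ν)) : P w := by
  rw [word_eta w]
  generalize w 0 = x
  generalize w 1 = y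
  generalize w 2 = z
  refine Fin.addCases (fun x => ?_) (fun x => ?_) x <;>
  refine Fin.addCases (fun y => ?_) (fun y => ?_) y <;>
  refine Fin.addCases (fun z => ?_) (fun z => ?_) z <;> solve_by_elim

/-- The part that the images under the four operations have in common. -/
def core {d : ℕ} (ν : ℕ) (S : Set (Word d)) (a : Fin d) : Set (Word (d + ν)) :=
  {w | w ∈ upWord ν '' S ∨ (∃ i, w ∈ replSet ν S a (Fin.natAdd d i)) ∨
    (∃ i, w ∈ leftSet ν S a (Fin.natAdd d i)) ∨ (∃ i, w ∈ rightSet ν S a (Fin.natAdd d i)) ∨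
    (∃ i j, i ≠ j ∧ w ∈ betweenSet ν S (Fin.natAdd d i) (Fin.natAdd d j)) ∨
    (∃ i, w ∈ midSet ν S (Fin.natAdd d i))}

lemma fCore_eq {d : ℕ} (S : Set (Word d)) (a : Fin d) : fCore S a = core 1 S a := by
  ext w
  simp only [fCore, core, Set.mem_union, Set.mem_ofPred_eq, Fin.exists_fin_one, new_eq]
  simp [or_assoc]

lemma gCore_eq {d : ℕ} (S : Set (Word d)) (a : Fin d) : gCore S a = core 2 S a := by
  ext w
  simp only [gCore, core, Set.mem_union, Set.mem_ofPred_eq, Fin.exists_fin_two]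
  simp [or_assoc]

/-- The words with two new digits beside each other. -/
def rest {d : ℕ} (ν : ℕ) (b : Bool) (S : Set (Word d)) : Set (Word (d + ν)) :=
  {w | (∃ i j, ¬ pairRel b i j ∧ w ∈ loopFirst ν S (Fin.natAdd d i) (Fin.natAdd d j)) ∨
    (∃ i j, pairRel b i j ∧ w ∈ loopLast ν S (Fin.natAdd d i) (Fin.natAdd d j)) ∨
    (∃ i j k, pairRel b i j ∧ ¬ pairRel b j k ∧
      w = ![Fin.natAdd d i, Fin.natAdd d j, Fin.natAdd d k])}

/-- Uniqueness of a removes the quantifier, and `pairRel` unifies the four operations. -/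
lemma mem_apply {d : ℕ} {S : Set (Word d)} {a : Fin d} (ha : IsDistinguished S a)
    (hu : ∀ a', IsDistinguished S a' → a' = a) (o : Op) (w : Word (d + o.deg)) :
    w ∈ o.apply S ↔ w ∈ core o.deg S a ∨ w ∈ rest o.deg o.primed S := by
  have key : ∀ P : Fin d → Prop, (∃ a', IsDistinguished S a' ∧ P a') ↔ P a := fun P =>
    ⟨fun ⟨a', h, hP⟩ => hu a' h ▸ hP, fun h => ⟨a, ha, h⟩⟩
  cases o
  · have h : ∀ w : Word (d + 1), w ∈ opF S ↔ w ∈ core 1 S a ∨ w ∈ rest 1 false S := fun w => by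
      simp only [opF, Set.mem_ofPred_eq, key, fCore_eq, Set.mem_union, rest]
      simp [pairRel, new_eq]
    exact h w
  · have h : ∀ w : Word (d + 1), w ∈ opF' S ↔ w ∈ core 1 S a ∨ w ∈ rest 1 true S := fun w => by
      simp only [opF', Set.mem_ofPred_eq, key, fCore_eq, Set.mem_union, rest]
      simp [pairRel, new_eq]
    exact h w
  · have h : ∀ w : Word (d + 2), w ∈ opG S ↔ w ∈ core 2 S a ∨ w ∈ rest 2 false S := fun w => by
      simp only [opG, Set.mem_ofPred_eq, key, gCore_eq, Set.mem_union, rest, Fin.exists_fin_two]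
      simp [pairRel, or_assoc]
    exact h w
  · have h : ∀ w : Word (d + 2), w ∈ opG' S ↔ w ∈ core 2 S a ∨ w ∈ rest 2 true S := fun w => by
      simp only [opG', Set.mem_ofPred_eq, key, gCore_eq, Set.mem_union, rest, Fin.exists_fin_two]
      simp [pairRel, or_assoc]
      tauto
    exact h w

-- The eight patterns of old and new digits are checked separately.
set_option linter.unusedSimpArgs false in
lemma mem_core_or_rest {d : ℕ} {c : Cfg d} {a : Fin d} (ha : IsDistinguished c.words a)
    (hX : c.Tight c.X) (hcard : #c.X ≤ 2) (ν : ℕ) (b : Bool) (w : Word (d + ν)) :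
    (w ∈ core ν c.words a ∨ w ∈ rest ν b c.words) ↔ w ∈ (c.ext ν b).words := by
  have ha' := Cfg.isDistinguished_iff.1 ha
  obtain ⟨haX, hT⟩ := ha'
  have hne : ∀ {x}, x ∉ c.X → x ≠ a := fun hx h => hx (h ▸ haX)
  have hTa : ∀ {x}, x ∉ c.X → c.T a x := fun hx => (hT _ (hne hx)).1
  have hHa : ∀ {x}, x ∉ c.X → c.H x a := fun hx => ⟨(hT _ (hne hx)).2, fun h => hne hx h.1⟩
  simp only [core, rest, Set.mem_ofPred_eq, mem_replSet ha hX hcard, mem_upWord_image, leftSet,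
    rightSet, midSet, betweenSet, loopFirst, loopLast, c.mem_loops, up]
  induction w using fin_add_cases with
  | h000 x y z =>
    simp [word_eq, Cfg.mem_words, castAdd_eq_iff, Cfg.castAdd_ne_natAdd, natAdd_ne_castAdd,
      natAdd_eq_iff]
  | h001 x y k =>
    simp [word_eq, Cfg.mem_words, castAdd_eq_iff, Cfg.castAdd_ne_natAdd, natAdd_ne_castAdd,
      natAdd_eq_iff]
    by_cases hx : x = a
    · subst hx; simp; exact hTa
    · simp [hx, and_comm]
  | h010 x z j =>
    simp [word_eq, Cfg.mem_words, castAdd_eq_iff, Cfg.castAdd_ne_natAdd, natAdd_ne_castAdd,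
      natAdd_eq_iff]
  | h100 y z i =>
    simp [word_eq, Cfg.mem_words, castAdd_eq_iff, Cfg.castAdd_ne_natAdd, natAdd_ne_castAdd,
      natAdd_eq_iff]
    by_cases hz : z = a
    · subst hz; simp; exact hHa
    · simp [hz]
  | h011 x j k =>
    simp [word_eq, Cfg.mem_words, castAdd_eq_iff, Cfg.castAdd_ne_natAdd, natAdd_ne_castAdd,
      natAdd_eq_iff]
    tauto
  | h101 y i k =>
    simp [word_eq, Cfg.mem_words, castAdd_eq_iff, Cfg.castAdd_ne_natAdd, natAdd_ne_castAdd,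
      natAdd_eq_iff]
    by_cases h : i = k
    · simp [h]
    · simp [h, Ne.symm h]
  | h110 z i j =>
    simp [word_eq, Cfg.mem_words, castAdd_eq_iff, Cfg.castAdd_ne_natAdd, natAdd_ne_castAdd,
      natAdd_eq_iff]
  | h111 i j k =>
    simp [word_eq, Cfg.mem_words, castAdd_eq_iff, Cfg.castAdd_ne_natAdd, natAdd_ne_castAdd,
      natAdd_eq_iff]

theorem Cfg.apply_words {d : ℕ} {c : Cfg d} (h : c.val = alpha d) (o : Op) :
    o.apply c.words = (c.ext o.deg o.primed).words := by
  obtain ⟨a, ha⟩ := c.exists_isDistinguished h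
  have h2 : #c.X ≤ 2 := by
    rcases (low_card_loops h).2 with h | h <;> omega
  ext w
  rw [mem_apply ha (fun a' => isDistinguished_unique ha),
    mem_core_or_rest ha (tight_loops h) h2]

lemma Cfg.val_ext_eq_alpha {d : ℕ} {c : Cfg d} (h : c.val = alpha d) (o : Op) :
    (c.ext o.deg o.primed).val = alpha (d + o.deg) := by
  have := (tight_loops h).val_ext_add o.deg o.primed o.deg_eq
  omega

/-! ### The action of permutations -/

section Action

variable {n : ℕ}

lemma smul_word (σ : Equiv.Perm (Fin n)) (x y z : Fin n) :
    σ • (![x, y, z] : Word n) = ![σ x, σ y, σ z] := by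
  ext i; fin_cases i <;> rfl

lemma mem_smul_words (σ : Equiv.Perm (Fin n)) (S : Set (Word n)) (x y z : Fin n) :
    ![x, y, z] ∈ σ • S ↔ ![σ⁻¹ x, σ⁻¹ y, σ⁻¹ z] ∈ S := by
  rw [Set.mem_smul_set_iff_inv_smul_mem, smul_word]

lemma smul_mem_smul_words (σ : Equiv.Perm (Fin n)) (S : Set (Word n)) (x y z : Fin n) :
    ![σ x, σ y, σ z] ∈ σ • S ↔ ![x, y, z] ∈ S := by
  simp [mem_smul_words]

lemma set_ext_words {S S' : Set (Word n)} (h : ∀ x y z, ![x, y, z] ∈ S ↔ ![x, y, z] ∈ S') :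
    S = S' := by
  ext w
  rw [word_eta w, h]

lemma smul_mem_loops (σ : Equiv.Perm (Fin n)) (S : Set (Word n)) (x : Fin n) :
    σ x ∈ loops (σ • S) ↔ x ∈ loops S := smul_mem_smul_words σ S x x x

lemma loops_smul (σ : Equiv.Perm (Fin n)) (S : Set (Word n)) :
    loops (σ • S) = σ '' loops S := by
  ext x
  obtain ⟨x, rfl⟩ := σ.surjective x
  rw [smul_mem_loops, σ.injective.mem_set_image]

lemma ncard_loops_smul (σ : Equiv.Perm (Fin n)) (S : Set (Word n)) :
    (loops (σ • S)).ncard = (loops S).ncard := by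
  rw [loops_smul, Set.ncard_image_of_injective _ σ.injective]

lemma m_smul (σ : Equiv.Perm (Fin n)) (S : Set (Word n)) (x : Fin n) :
    m (σ x) (σ • S) = m x S := by
  rw [m, m, ← Set.ncard_image_of_injective (missing x S) σ.injective]
  congr 1
  ext y
  obtain ⟨y, rfl⟩ := σ.surjective y
  rw [σ.injective.mem_set_image]
  exact not_congr (smul_mem_smul_words σ S x y x)

namespace Cfg

variable (c : Cfg n) (σ : Equiv.Perm (Fin n))

/-- The image of a configuration under a permutation of the digits. -/
def perm : Cfg n where
  X := c.X.map σ.toEmbedding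
  T x y := c.T (σ⁻¹ x) (σ⁻¹ y)
  loop x hx := by
    obtain ⟨z, hz, rfl⟩ := mem_map.1 hx
    simpa using c.loop z hz

lemma mem_perm_X {x : Fin n} : x ∈ (c.perm σ).X ↔ σ⁻¹ x ∈ c.X := by
  obtain ⟨x, rfl⟩ := σ.surjective x
  simp [perm]

lemma perm_H {x y : Fin n} : (c.perm σ).H x y ↔ c.H (σ⁻¹ x) (σ⁻¹ y) := by
  rw [H, H, mem_perm_X, (σ⁻¹).injective.eq_iff]
  rfl

lemma words_perm : (c.perm σ).words = σ • c.words := by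
  refine set_ext_words fun x y z => ?_
  rw [mem_smul_words, mem_words, mem_words, mem_perm_X, perm_H, (σ⁻¹).injective.eq_iff,
    (σ⁻¹).injective.eq_iff]
  rfl

lemma val_perm : (c.perm σ).val = c.val := by
  rw [← ncard_words, ← ncard_words, words_perm]
  exact Set.ncard_image_of_injective _ (MulAction.injective σ)

end Cfg

end Action

/-! ### Permutations that respect old and new digits -/

section Lift

variable {d ν : ℕ}

/-- A permutation of the old digits and one of the new digits, combined. -/
def lift (d ν : ℕ) :
    Equiv.Perm (Fin d) × Equiv.Perm (Fin ν) →* Equiv.Perm (Fin (d + ν)) :=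
  (finSumFinEquiv (m := d) (n := ν)).permCongrHom.toMonoidHom.comp (Equiv.Perm.sumCongrHom _ _)

@[simp] lemma lift_castAdd (τ : Equiv.Perm (Fin d)) (ρ : Equiv.Perm (Fin ν)) (x : Fin d) :
    lift d ν (τ, ρ) (Fin.castAdd ν x) = Fin.castAdd ν (τ x) := by
  simp [lift, Equiv.permCongrHom]

@[simp] lemma lift_natAdd (τ : Equiv.Perm (Fin d)) (ρ : Equiv.Perm (Fin ν)) (i : Fin ν) :
    lift d ν (τ, ρ) (Fin.natAdd d i) = Fin.natAdd d (ρ i) := by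
  simp [lift, Equiv.permCongrHom]

lemma lift_injective : Function.Injective (lift d ν) := by
  intro x y h
  exact Equiv.Perm.sumCongrHom_injective ((finSumFinEquiv (m := d) (n := ν)).permCongrHom.injective h)

lemma exists_lift {σ : Equiv.Perm (Fin (d + ν))}
    (h : ∀ i : Fin ν, ∃ j : Fin ν, σ (Fin.natAdd d i) = Fin.natAdd d j) :
    ∃ τ ρ, σ = lift d ν (τ, ρ) := by
  have h1 : Set.MapsTo σ (Set.range (Fin.natAdd d : Fin ν → _)) (Set.range (Fin.natAdd d)) := by
    rintro _ ⟨i, rfl⟩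
    obtain ⟨j, hj⟩ := h i
    exact ⟨j, hj.symm⟩
  have h2 : σ '' (Set.range (Fin.natAdd d : Fin ν → _)) = Set.range (Fin.natAdd d) :=
    Set.eq_of_subset_of_ncard_le h1.image_subset
      (Set.ncard_image_of_injective _ σ.injective).ge
  have h3 : ∀ x : Fin d, ∃ y : Fin d, σ (Fin.castAdd ν x) = Fin.castAdd ν y := by
    intro x
    refine Fin.addCases (motive := fun z => σ (Fin.castAdd ν x) = z → _) (fun y hy => ⟨y, hy⟩)
      (fun j hj => ?_) _ rfl
    have : σ (Fin.castAdd ν x) ∈ σ '' (Set.range (Fin.natAdd d : Fin ν → _)) := by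
      rw [h2]; exact ⟨j, hj.symm⟩
    rw [σ.injective.mem_set_image] at this
    obtain ⟨i, hi⟩ := this
    exact absurd hi (natAdd_ne_castAdd x i)
  have h4 : finSumFinEquiv.permCongrHom.symm σ ∈
      (Equiv.Perm.sumCongrHom (Fin d) (Fin ν)).range := by
    refine Equiv.Perm.mem_sumCongrHom_range_of_perm_mapsTo_inl ?_
    rintro _ ⟨x, rfl⟩
    obtain ⟨y, hy⟩ := h3 x
    exact ⟨y, by simp [Equiv.permCongrHom, hy]⟩
  obtain ⟨⟨τ, ρ⟩, hτ⟩ := h4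
  refine ⟨τ, ρ, ?_⟩
  simp only [lift, MonoidHom.comp_apply, hτ]
  exact ((finSumFinEquiv (m := d) (n := ν)).permCongrHom.apply_symm_apply σ).symm

lemma pairRel_perm {b : Bool} (ρ : Equiv.Perm (Fin ν)) {i j : Fin ν} :
    pairRel b (ρ i) (ρ j) ↔ pairRel b i j := by
  simp [pairRel]

variable (c : Cfg d) (b : Bool)

/-- Equality and inequality are invariant under every ρ, so ρ leaves no trace on the right. -/
lemma Cfg.smul_words_ext (τ : Equiv.Perm (Fin d)) (ρ : Equiv.Perm (Fin ν)) :
    lift d ν (τ, ρ) • (c.ext ν b).words = ((c.perm τ).ext ν b).words := by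
  have hi : (lift d ν (τ, ρ))⁻¹ = lift d ν (τ⁻¹, ρ⁻¹) := (map_inv (lift d ν) (τ, ρ)).symm
  have hT : ∀ x y, ((c.ext ν b).perm (lift d ν (τ, ρ))).T x y ↔ ((c.perm τ).ext ν b).T x y := by
    intro x y
    change (c.ext ν b).T ((lift d ν (τ, ρ))⁻¹ x) ((lift d ν (τ, ρ))⁻¹ y) ↔ _
    rw [hi]
    refine Fin.addCases (fun x => ?_) (fun x => ?_) x <;>
      refine Fin.addCases (fun y => ?_) (fun y => ?_) y <;>
      simp [Cfg.mem_perm_X, pairRel_perm, -Equiv.Perm.coe_inv]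
    rfl
  have hX : ∀ x, x ∈ ((c.ext ν b).perm (lift d ν (τ, ρ))).X ↔ x ∈ ((c.perm τ).ext ν b).X := by
    intro x
    rw [Cfg.mem_perm_X, hi]
    refine Fin.addCases (fun x => ?_) (fun x => ?_) x <;> simp [Cfg.mem_perm_X]
  rw [← Cfg.words_perm]
  refine set_ext_words fun x y z => ?_
  simp only [Cfg.mem_words, Cfg.H, hT, hX]

lemma Cfg.mem_words_of_ext {x y z : Fin d} :
    ![Fin.castAdd ν x, Fin.castAdd ν y, Fin.castAdd ν z] ∈ (c.ext ν b).words ↔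
      ![x, y, z] ∈ c.words := by
  simp [Cfg.mem_words]

end Lift

/-! ### Removing a layer, and the seeds -/

/-- An alphabet size together with a set of sets of words. -/
abbrev SizedOrbit : Type := (d : ℕ) × Set (Set (Word d))

lemma Op.exists_deg_primed {ν : ℕ} (hν : ν = 1 ∨ ν = 2) (b : Bool) :
    ∃ o : Op, o.deg = ν ∧ o.primed = b := by
  rcases hν with rfl | rfl <;> cases b
  exacts [⟨.f, rfl, rfl⟩, ⟨.f', rfl, rfl⟩, ⟨.g, rfl, rfl⟩, ⟨.g', rfl, rfl⟩]

lemma exists_perm_natAdd {d ν : ℕ} {N : Finset (Fin (d + ν))} (h : #N = ν) :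
    ∃ σ : Equiv.Perm (Fin (d + ν)), (∀ i, σ⁻¹ (Fin.natAdd d i) ∈ N) ∧
      ∀ x, σ⁻¹ (Fin.castAdd ν x) ∉ N := by
  have h' : #N = #(univ.map (Fin.natAddEmb d : Fin ν ↪ Fin (d + ν))) := by simp [h]
  let e := Finset.equivOfCardEq h'
  have hm : ∀ x, x ∈ N → e.extendSubtype x ∈ univ.map (Fin.natAddEmb d : Fin ν ↪ _) :=
    fun x hx => e.extendSubtype_mem x hx
  have hn : ∀ x, x ∉ N → e.extendSubtype x ∉ univ.map (Fin.natAddEmb d : Fin ν ↪ _) :=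
    fun x hx => e.extendSubtype_not_mem x hx
  refine ⟨e.extendSubtype, fun i => ?_, fun x hx => ?_⟩
  · by_contra hi
    have := hn _ hi
    simp only [Equiv.Perm.coe_inv, Equiv.apply_symm_apply] at this
    exact this (mem_map_of_mem _ (mem_univ i))
  · have := hm _ hx
    simp only [Equiv.Perm.coe_inv, Equiv.apply_symm_apply] at this
    obtain ⟨i, -, hi⟩ := mem_map.1 this
    exact natAdd_ne_castAdd x i hi

/-- Move the layer of `exists_layer` to the last digits and restrict to the others. -/
theorem Cfg.exists_apply {n : ℕ} {c : Cfg n} (h : c.val = alpha n) (hX : #c.X < n) :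
    ∃ (d : ℕ) (o : Op) (c' : Cfg d), 0 < d ∧ c'.val = alpha d ∧
      (⟨n, orbit c.words⟩ : SizedOrbit) = ⟨d + o.deg, orbit (o.apply c'.words)⟩ := by
  obtain ⟨N, b, hN, hdis, ht, hT⟩ := exists_layer h hX
  obtain ⟨o, ho, rfl⟩ := Op.exists_deg_primed hN b
  have htX := tight_loops h
  have hle : #c.X + #N ≤ n := by
    rw [← card_union_of_disjoint hdis]
    exact (card_le_univ _).trans_eq (Fintype.card_fin n)
  have hX1 : 0 < #c.X := by rcases (low_card_loops h).2 with h | h <;> omega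
  obtain ⟨d, rfl⟩ : ∃ d, n = d + o.deg := ⟨n - o.deg, by omega⟩
  obtain ⟨σ, hnew, hold⟩ := exists_perm_natAdd ho.symm
  have hnewX : ∀ i, σ⁻¹ (Fin.natAdd d i) ∉ c.X := fun i hi => disjoint_left.1 hdis hi (hnew i)
  let c' : Cfg d :=
    ⟨{x | Fin.castAdd o.deg x ∈ (c.perm σ).X},
      fun x y => (c.perm σ).T (Fin.castAdd o.deg x) (Fin.castAdd o.deg y),
      fun x hx => (c.perm σ).loop _ (mem_filter.1 hx).2⟩
  have hmem : ∀ x, x ∈ c'.X ↔ σ⁻¹ (Fin.castAdd o.deg x) ∈ c.X := fun x => by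
    simp only [c', mem_filter, mem_univ, true_and, mem_perm_X]
  have eX : ∀ x, x ∈ (c.perm σ).X ↔ x ∈ (c'.ext o.deg o.primed).X := by
    refine Fin.addCases (fun x => ?_) (fun i => ?_)
    · rw [ext_old_mem, hmem, mem_perm_X]
    · simp only [ext_new_mem, iff_false, mem_perm_X]
      exact hnewX i
  -- Between old and new digits, tightness of X and of X ∪ N leaves no choice.
  have eT : ∀ x y, (c.perm σ).T x y ↔ (c'.ext o.deg o.primed).T x y := by
    refine Fin.addCases (fun x => Fin.addCases (fun y => ?_) (fun j => ?_))
      (fun i => Fin.addCases (fun y => ?_) (fun j => ?_))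
    · rw [ext_T_old_old]
    · rw [ext_T_old_new, hmem]
      refine ⟨fun hh => ?_, fun hx => (htX _ hx _ (hnewX j)).1⟩
      by_contra hx
      exact (ht _ (mem_union_right _ (hnew j)) _ (by simp only [mem_union, hx, hold x, or_self,
        not_false_eq_true])).2 hh
    · rw [ext_T_new_old, hmem]
      refine ⟨fun hh hy => (htX _ hy _ (hnewX i)).2 hh, fun hy => ?_⟩
      exact (ht _ (mem_union_right _ (hnew i)) _ (by simp only [mem_union, hy, hold y, or_self,
        not_false_eq_true])).1
    · rw [ext_T_new_new]
      refine (hT _ (hnew i) _ (hnew j)).trans ?_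
      simp [pairRel, -Equiv.Perm.coe_inv]
  have ew : σ • c.words = (c'.ext o.deg o.primed).words := by
    rw [← words_perm]
    refine set_ext_words fun x y z => ?_
    simp only [mem_words, H, eX, eT]
  have htX' : c'.Tight c'.X := by
    intro x hx y hy
    rw [hmem] at hx hy
    exact htX _ hx _ hy
  have hval : (c'.ext o.deg o.primed).val = alpha (d + o.deg) := by
    rw [← ncard_words, ← ew, ← words_perm, ncard_words, val_perm, h]
  have hval' : c'.val = alpha d := by
    have := htX'.val_ext_add o.deg o.primed o.deg_eq
    omega
  refine ⟨d, o, c', by omega, hval', ?_⟩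
  rw [apply_words hval', ← ew]
  congr 1
  exact (MulAction.orbit_smul σ c.words).symm

/-- The configuration of `{000}`. -/
def oneCfg : Cfg 1 := ⟨univ, fun _ _ => False, fun _ _ h => h⟩

/-- The configuration of `{000, 010, 111}`. -/
def twoCfg : Cfg 2 := ⟨univ, fun x y => x = 0 ∧ y = 1, fun _ _ h => zero_ne_one (h.1.symm.trans h.2)⟩

lemma words_of_one {c : Cfg 1} (h : c.X = univ) : c.words = {![0, 0, 0]} := by
  refine set_ext_words fun x y z => ?_
  rw [Subsingleton.elim x 0, Subsingleton.elim y 0, Subsingleton.elim z 0]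
  simp [Cfg.mem_words, h]

lemma words_two : twoCfg.words = {![0, 0, 0], ![0, 1, 0], ![1, 1, 1]} := by
  refine set_ext_words fun x y z => ?_
  simp only [Set.mem_insert_iff, Set.mem_singleton_iff, word_eq, two_iff]
  simp [Cfg.mem_words, Cfg.H, twoCfg]

lemma val_one : oneCfg.val = alpha 1 := by
  simp [Cfg.val, alpha, Cfg.p, oneCfg]

lemma val_two : twoCfg.val = alpha 2 := by
  rw [← Cfg.ncard_words, words_two, Set.ncard_eq_three.2
    ⟨_, _, _, by simp, by simp, by simp, rfl⟩]
  simp [alpha, sum_range_succ]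

lemma Seed.start_one : Seed.one.start = ⟨1, orbit oneCfg.words⟩ := by
  rw [words_of_one rfl]
  change (⟨1, _⟩ : SizedOrbit) = ⟨1, _⟩
  congr 1
  ext S
  simp only [Set.mem_singleton_iff, MulAction.mem_orbit_iff]
  constructor
  · rintro rfl; exact ⟨1, one_smul _ _⟩
  · rintro ⟨σ, rfl⟩; rw [Subsingleton.elim σ 1, one_smul]

lemma Seed.start_two : Seed.two.start = ⟨2, orbit twoCfg.words⟩ := by
  rw [words_two]; rfl

lemma Seed.exists_cfg (s : Seed) : ∃ (n : ℕ) (c : Cfg n), 0 < n ∧ c.val = alpha n ∧ c.X = univ ∧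
    s.start = ⟨n, orbit c.words⟩ := by
  cases s
  · exact ⟨1, oneCfg, one_pos, val_one, rfl, start_one⟩
  · exact ⟨2, twoCfg, two_pos, val_two, rfl, start_two⟩

theorem Cfg.exists_seed {n : ℕ} {c : Cfg n} (h : c.val = alpha n) (hX : #c.X = n) :
    ∃ s : Seed, s.start = (⟨n, orbit c.words⟩ : SizedOrbit) := by
  have hu : c.X = univ := by rw [← card_eq_iff_eq_univ, hX, Fintype.card_fin]
  have h12 := (low_card_loops h).2
  rw [hX] at h12
  rcases h12 with rfl | rfl
  · refine ⟨.one, ?_⟩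
    rw [Seed.start_one, words_of_one rfl, words_of_one hu]
  · refine ⟨.two, ?_⟩
    rw [Seed.start_two]
    congr 1
    obtain ⟨a, -, ha⟩ := exists_source h
    have hl : ∀ x, ¬ c.T x x := fun x => c.loop x (by simp [hu])
    suffices hw : c.words = Equiv.swap 0 a • twoCfg.words by
      rw [hw]
      exact (MulAction.orbit_smul _ _).symm
    have hT : ∀ x y, c.T x y ↔ x = a ∧ y ≠ a := by
      intro x y
      by_cases hxy : x = y
      · subst hxy; simp [hl]
      · by_cases hx : x = a
        · subst hx; simp [(ha y (Ne.symm hxy)).1, Ne.symm hxy]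
        · have : y = a := by omega
          subst this
          simp [(ha x hx).2]
    refine set_ext_words fun x y z => ?_
    rw [mem_smul_words, Equiv.swap_inv, mem_words, mem_words]
    -- All digits are loops and the tails are determined by the source a, so a finite check remains.
    simp only [H, hT, hu, mem_univ, and_true, swap_conj_iff, twoCfg]

/-! ### Recognising the new digits; injectivity of the operations -/

lemma pairRel_comm {α : Type*} {b : Bool} {i j : α} : pairRel b i j ↔ pairRel b j i := by
  unfold pairRel
  split_ifs
  · exact eq_comm
  · exact ne_comm

lemma Cfg.ncard_loops {n : ℕ} (c : Cfg n) : (loops c.words).ncard = #c.X := by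
  rw [c.loops_words, Set.ncard_coe_finset]

lemma Cfg.m_words {n : ℕ} (c : Cfg n) {x : Fin n} (hx : x ∉ c.X) :
    m x c.words = #{y | ¬ (c.T x y ∧ c.H y x)} := by
  rw [m, ← Set.ncard_coe_finset]
  congr 1
  ext y
  simp only [missing, Set.mem_ofPred_eq, c.mem_words, hx, and_false, false_or, coe_filter, mem_univ,
    true_and]

section

variable {d ν : ℕ} (c : Cfg d) (b : Bool)

/-- Missing are the loops, and all new digits because `pairRel` is symmetric. -/
lemma Cfg.m_ext_new (i : Fin ν) : m (Fin.natAdd d i) (c.ext ν b).words = #c.X + ν := by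
  have hi : ∀ j, ¬ (pairRel b i j ∧ ¬ pairRel b j i) := fun j h => h.2 (pairRel_comm.1 h.1)
  rw [m_words _ (ext_new_mem c ν b i), card_filter, Fin.sum_univ_add]
  simp only [ext_T_new_old, ext_H_old_new, ext_T_new_new, ext_H_new_new, hi, and_self, not_not]
  simp

variable {c}

/-- Loops and new digits are missing, and so is x itself; hence the strict inequality. -/
lemma Cfg.m_ext_old (hX : c.Tight c.X) {x : Fin d} (hx : x ∉ c.X) :
    #c.X + ν < m (Fin.castAdd ν x) (c.ext ν b).words := by
  rw [m_words _ (by simpa using hx), card_filter, Fin.sum_univ_add, ← card_filter, ← card_filter]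
  simp only [ext_T_old_new, ext_T_old_old, ext_H_old_old, hx, false_and, not_false_eq_true,
    filter_true, card_univ, Fintype.card_fin, add_lt_add_iff_right]
  refine card_lt_card ⟨fun y hy => ?_, fun h => hx (h ?_)⟩
  · simp only [mem_filter, mem_univ, true_and]
    exact fun hh => hh.2.1 (hX y hy x hx).1
  · simp only [mem_filter, mem_univ, true_and]
    exact fun hh => hh.2.1 hh.1

lemma Cfg.m_ext_eq_iff (hX : c.Tight c.X) {x : Fin (d + ν)} :
    (x ∉ loops (c.ext ν b).words ∧
      m x (c.ext ν b).words = (loops (c.ext ν b).words).ncard + ν) ↔ ∃ i, x = Fin.natAdd d i := by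
  rw [ncard_loops, card_ext_X, mem_loops]
  constructor
  · rintro ⟨h1, h2⟩
    refine Fin.addCases (motive := fun z => x = z → _) (fun y hy => ?_) (fun i hi => ⟨i, hi⟩) x rfl
    subst hy
    have := m_ext_old (ν := ν) b hX (x := y) (by simpa using h1)
    omega
  · rintro ⟨i, rfl⟩
    exact ⟨ext_new_mem c ν b i, m_ext_new c b i⟩

lemma Cfg.le_m_ext (hX : c.Tight c.X) {x : Fin (d + ν)} (hx : x ∉ loops (c.ext ν b).words) :
    (loops (c.ext ν b).words).ncard + ν ≤ m x (c.ext ν b).words := by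
  rw [ncard_loops, card_ext_X]
  rw [mem_loops] at hx
  revert hx
  refine Fin.addCases (fun y => ?_) (fun i => ?_) x
  · intro hx
    exact (m_ext_old b hX (by simpa using hx)).le
  · rw [m_ext_new]; simp

end

/-- A permutation that maps one image under an operation to another one preserves the new digits. -/
lemma Cfg.exists_lift_of_smul_eq {d ν : ℕ} {c c' : Cfg d} {b b' : Bool} (hX : c.Tight c.X)
    (hX' : c'.Tight c'.X) {σ : Equiv.Perm (Fin (d + ν))}
    (h : σ • (c.ext ν b).words = (c'.ext ν b').words) :
    ∃ τ ρ, σ = lift d ν (τ, ρ) := by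
  refine exists_lift fun i => ?_
  -- New digits are characterised by loops and `m`, both of which σ transports.
  have h1 := (m_ext_eq_iff b hX (x := Fin.natAdd d i)).2 ⟨i, rfl⟩
  rwa [← smul_mem_loops σ, ← m_smul σ, ← ncard_loops_smul σ, h, m_ext_eq_iff b' hX'] at h1

lemma Cfg.smul_words_eq {d ν : ℕ} {c c' : Cfg d} {b b' : Bool} {τ : Equiv.Perm (Fin d)}
    {ρ : Equiv.Perm (Fin ν)}
    (h : lift d ν (τ, ρ) • (c.ext ν b).words = (c'.ext ν b').words) : τ • c.words = c'.words := by
  rw [smul_words_ext] at h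
  rw [← words_perm]
  refine set_ext_words fun x y z => ?_
  rw [← mem_words_of_ext (ν := ν) (c.perm τ) b, h, mem_words_of_ext]

/-- For a loop a and a new digit i, the word aii is present exactly if ii is not a tail. -/
lemma Cfg.bool_eq {d ν : ℕ} {c c' : Cfg d} {b b' : Bool} (hc : c.X.Nonempty) (hν : 0 < ν)
    (h : (c.ext ν b).words = (c'.ext ν b').words) : b = b' := by
  obtain ⟨a, ha⟩ := hc
  have ha' : a ∈ c'.X := by
    rw [← ext_old_mem c' ν b', ← mem_loops, ← h, mem_loops, ext_old_mem]; exact ha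
  have h1 : (![Fin.castAdd ν a, Fin.natAdd d ⟨0, hν⟩, Fin.natAdd d ⟨0, hν⟩] : Word (d + ν)) ∈
      (c.ext ν b).words ↔ ![Fin.castAdd ν a, Fin.natAdd d ⟨0, hν⟩, Fin.natAdd d ⟨0, hν⟩] ∈
      (c'.ext ν b').words := by rw [h]
  simp only [mem_words, castAdd_ne_natAdd, false_and, false_or, ext_T_old_new, ha, ha', true_and,
    ext_H_new_new, not_iff_not] at h1
  cases b <;> cases b' <;> simp [pairRel] at h1 ⊢

/-- In some element of the orbit there is a non-loop `x` such that exactly one digit more than the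
number of loops does not appear between `x`. -/
def HasSingle (Ω : SizedOrbit) : Prop :=
  ∃ S ∈ Ω.2, ∃ x ∉ loops S, m x S = (loops S).ncard + 1

lemma hasSingle_iff {n : ℕ} {S : Set (Word n)} : HasSingle ⟨n, orbit S⟩ ↔
    ∃ x ∉ loops S, m x S = (loops S).ncard + 1 := by
  constructor
  · rintro ⟨_, ⟨σ, rfl⟩, x, hx, hm⟩
    obtain ⟨x, rfl⟩ := σ.surjective x
    refine ⟨x, ?_, ?_⟩
    · rwa [← smul_mem_loops σ]
    · rwa [← m_smul σ, ← ncard_loops_smul σ]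
  · rintro h
    exact ⟨S, MulAction.mem_orbit_self S, h⟩

/-- `HasSingle` detects the layer size. The connecting permutation then splits, and its old part
connects the preimages. -/
theorem Cfg.apply_injective {d d' : ℕ} {c : Cfg d} {c' : Cfg d'} (h : c.val = alpha d)
    (h' : c'.val = alpha d') {o o' : Op}
    (e : (⟨d + o.deg, orbit (o.apply c.words)⟩ : SizedOrbit) =
      ⟨d' + o'.deg, orbit (o'.apply c'.words)⟩) :
    o = o' ∧ (⟨d, orbit c.words⟩ : SizedOrbit) = ⟨d', orbit c'.words⟩ := by
  have hX := tight_loops h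
  have hX' := tight_loops h'
  rw [apply_words h, apply_words h'] at e
  have key : ∀ {d : ℕ} {c : Cfg d} {o : Op}, c.Tight c.X →
      (HasSingle ⟨d + o.deg, orbit (c.ext o.deg o.primed).words⟩ ↔ o.deg = 1) := by
    intro d c o hX
    rw [hasSingle_iff]
    constructor
    · rintro ⟨x, hx, hm⟩
      have := le_m_ext _ hX hx
      have := o.deg_eq
      omega
    · intro ho
      have := (m_ext_eq_iff (ν := o.deg) o.primed hX).2 ⟨⟨0, by omega⟩, rfl⟩
      exact ⟨_, this.1, by rw [this.2, ho]⟩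
  have hdeg : o.deg = o'.deg := by
    have h1 := key (o := o) hX
    rw [e, key hX'] at h1
    have := o.deg_eq
    have := o'.deg_eq
    omega
  rw [← hdeg] at e
  have hd : d + o.deg = d' + o.deg := congrArg Sigma.fst e
  obtain rfl : d = d' := by omega
  have e := eq_of_heq (Sigma.mk.inj e).2
  have hmem : (c'.ext o.deg o'.primed).words ∈ orbit (c.ext o.deg o.primed).words := by
    rw [e]; exact MulAction.mem_orbit_self _
  obtain ⟨σ, hσ⟩ := hmem
  obtain ⟨τ, ρ, rfl⟩ := exists_lift_of_smul_eq hX hX' hσ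
  have h1 := smul_words_eq hσ
  have h2 : o.primed = o'.primed := by
    refine bool_eq (c := c.perm τ) (ν := o.deg) ?_ (by have := o.deg_eq; omega)
      ((smul_words_ext c _ τ ρ).symm.trans hσ)
    obtain ⟨a, ha, -⟩ := exists_source h
    exact ⟨τ a, by simpa [mem_perm_X] using ha⟩
  refine ⟨Op.ext_iff.2 ⟨hdeg, h2⟩, ?_⟩
  rw [← h1]
  congr 1
  exact (MulAction.orbit_smul τ c.words).symm

theorem Cfg.apply_smul {d : ℕ} {c : Cfg d} (h : c.val = alpha d) (o : Op)
    (τ : Equiv.Perm (Fin d)) :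
    o.apply (τ • c.words) = lift d o.deg (τ, 1) • o.apply c.words := by
  rw [apply_words h, smul_words_ext, ← words_perm, apply_words ((c.val_perm τ).trans h)]

theorem Cfg.onOrbit_eq {d : ℕ} {c : Cfg d} (h : c.val = alpha d) (o : Op) :
    o.onOrbit (orbit c.words) = orbit (o.apply c.words) := by
  have : ∀ S ∈ orbit c.words, orbit (o.apply S) = orbit (o.apply c.words) := by
    rintro _ ⟨τ, rfl⟩
    change orbit (o.apply (τ • c.words)) = _
    rw [apply_smul h]
    exact MulAction.orbit_smul _ _
  unfold Op.onOrbit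
  rw [Set.iUnion₂_congr this]
  exact Set.biUnion_const ⟨_, MulAction.mem_orbit_self _⟩ _

/-- In a seed every digit is a loop, whereas new digits never are. -/
theorem Cfg.apply_ne_start {d : ℕ} {c : Cfg d} (h : c.val = alpha d) (o : Op) (s : Seed) :
    (⟨d + o.deg, orbit (o.apply c.words)⟩ : SizedOrbit) ≠ s.start := by
  intro e
  obtain ⟨n, c', -, -, hu, hs⟩ := s.exists_cfg
  rw [hs, apply_words h] at e
  have h1 : ∀ x, x ∈ loops c'.words := fun x => by rw [mem_loops, hu]; exact mem_univ x
  have hall : ∃ S ∈ (⟨n, orbit c'.words⟩ : SizedOrbit).2, ∀ x, x ∈ loops S :=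
    ⟨_, MulAction.mem_orbit_self _, h1⟩
  rw [← e] at hall
  obtain ⟨_, ⟨σ, rfl⟩, hS⟩ := hall
  have := hS (σ (Fin.natAdd d ⟨0, by have := o.deg_eq; omega⟩))
  exact ext_new_mem c o.deg o.primed _ ((mem_loops _).1 ((smul_mem_loops σ _ _).1 this))

/-! ### Stabilizers -/

/-- The stabilizer of the image of `S` under an operation. -/
theorem Cfg.stab_apply {d : ℕ} {c : Cfg d} (h : c.val = alpha d) (o : Op) :
    stab (o.apply c.words) = ((stab c.words).prod ⊤).map (lift d o.deg) := by
  rw [apply_words h]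
  have hX := tight_loops h
  ext σ
  simp only [MulAction.mem_stabilizer_iff, Subgroup.mem_map, Subgroup.mem_prod, Subgroup.mem_top,
    and_true, Prod.exists]
  constructor
  · intro hσ
    obtain ⟨τ, ρ, rfl⟩ := exists_lift_of_smul_eq hX hX hσ
    exact ⟨τ, ρ, smul_words_eq hσ, rfl⟩
  · rintro ⟨τ, ρ, hτ, rfl⟩
    rw [smul_words_ext]
    have hw : (c.perm τ).words = c.words := by rw [words_perm, hτ]
    rw [← apply_words h, ← apply_words ((c.val_perm τ).trans h), hw]

/-- The subgroup is generated by pairwise disjoint transpositions and has order `2 ^ k`. -/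
def SwapGenerated {α : Type*} [DecidableEq α] (G : Subgroup (Equiv.Perm α)) (k : ℕ) : Prop :=
  (∃ T : Set (Equiv.Perm α), (∀ τ ∈ T, τ.IsSwap) ∧ T.Pairwise Equiv.Perm.Disjoint ∧
    G = Subgroup.closure T) ∧ Nat.card G = 2 ^ k

lemma swapGenerated_bot {α : Type*} [DecidableEq α] :
    SwapGenerated (⊥ : Subgroup (Equiv.Perm α)) 0 :=
  ⟨⟨∅, by simp, by simp, by simp⟩, by simp⟩

lemma SwapGenerated.map_conj {α : Type*} [DecidableEq α] {G : Subgroup (Equiv.Perm α)} {k : ℕ}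
    (h : SwapGenerated G k) (σ : Equiv.Perm α) :
    SwapGenerated (G.map (MulAut.conj σ).toMonoidHom) k := by
  obtain ⟨⟨T, hT, hd, rfl⟩, hk⟩ := h
  refine ⟨⟨(MulAut.conj σ).toMonoidHom '' T, ?_, ?_, ?_⟩, ?_⟩
  · rintro _ ⟨τ, hτ, rfl⟩
    obtain ⟨x, y, hxy, rfl⟩ := hT τ hτ
    refine ⟨σ x, σ y, σ.injective.ne hxy, ?_⟩
    rw [Equiv.swap_apply_apply]
    rfl
  · rintro _ ⟨τ, hτ, rfl⟩ _ ⟨τ', hτ', rfl⟩ hne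
    exact (hd hτ hτ' fun h => hne (by rw [h])).conj σ
  · rw [MonoidHom.map_closure]
  · rw [← hk]
    exact (Nat.card_congr (Subgroup.equivMapOfInjective _ _ (MulAut.conj σ).injective).toEquiv).symm

lemma Cfg.stab_smul {d : ℕ} (S : Set (Word d)) (σ : Equiv.Perm (Fin d)) :
    stab (σ • S) = (stab S).map (MulAut.conj σ).toMonoidHom :=
  MulAction.stabilizer_smul_eq_stabilizer_map_conj σ S

lemma swapGenerated_top {ν : ℕ} (hν : ν = 1 ∨ ν = 2) :
    SwapGenerated (⊤ : Subgroup (Equiv.Perm (Fin ν))) (ν - 1) := by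
  rcases hν with rfl | rfl
  · rw [← Subsingleton.elim ⊥ (⊤ : Subgroup (Equiv.Perm (Fin 1)))]
    exact swapGenerated_bot
  · refine ⟨⟨{Equiv.swap 0 1}, ?_, by simp, ?_⟩, ?_⟩
    · rintro _ rfl
      exact ⟨0, 1, by simp, rfl⟩
    · rw [eq_comm, Subgroup.eq_top_iff']
      intro σ
      have : σ = 1 ∨ σ = Equiv.swap 0 1 := by revert σ; decide
      rcases this with rfl | rfl
      · exact one_mem _
      · exact Subgroup.subset_closure rfl
    · simp [Nat.card_eq_fintype_card, Fintype.card_perm]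

lemma SwapGenerated.map_lift {d ν : ℕ} {G : Subgroup (Equiv.Perm (Fin d))}
    {K : Subgroup (Equiv.Perm (Fin ν))} {j k : ℕ} (hG : SwapGenerated G j)
    (hK : SwapGenerated K k) : SwapGenerated ((G.prod K).map (lift d ν)) (j + k) := by
  obtain ⟨⟨T, hT, hd, rfl⟩, hj⟩ := hG
  obtain ⟨⟨U, hU, hd', rfl⟩, hk⟩ := hK
  let e₁ := (lift d ν).comp (MonoidHom.inl _ _)
  let e₂ := (lift d ν).comp (MonoidHom.inr _ _)
  have l1 : ∀ τ x, e₁ τ (Fin.castAdd ν x) = Fin.castAdd ν (τ x) := fun τ x => lift_castAdd τ 1 x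
  have l2 : ∀ τ i, e₁ τ (Fin.natAdd d i) = Fin.natAdd d i := fun τ i => lift_natAdd τ 1 i
  have r1 : ∀ τ x, e₂ τ (Fin.castAdd ν x) = Fin.castAdd ν x := fun τ x => lift_castAdd 1 τ x
  have r2 : ∀ τ i, e₂ τ (Fin.natAdd d i) = Fin.natAdd d (τ i) := fun τ i => lift_natAdd 1 τ i
  have hlr : ∀ τ ρ, (e₁ τ).Disjoint (e₂ ρ) := fun τ ρ =>
    Fin.addCases (fun x => Or.inr (r1 ρ x)) (fun i => Or.inl (l2 τ i))
  refine ⟨⟨e₁ '' T ∪ e₂ '' U, ?_, ?_, ?_⟩, ?_⟩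
  · rintro _ (⟨τ, hτ, rfl⟩ | ⟨τ, hτ, rfl⟩)
    · obtain ⟨x, y, hxy, rfl⟩ := hT τ hτ
      refine ⟨Fin.castAdd ν x, Fin.castAdd ν y, by simpa [castAdd_eq_iff] using hxy, ?_⟩
      refine Equiv.ext (Fin.addCases (fun z => ?_) fun z => ?_)
      · rw [l1, (Fin.castAdd_injective d ν).map_swap]
      · rw [l2, Equiv.swap_apply_of_ne_of_ne (natAdd_ne_castAdd _ _) (natAdd_ne_castAdd _ _)]
    · obtain ⟨x, y, hxy, rfl⟩ := hU τ hτ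
      refine ⟨Fin.natAdd d x, Fin.natAdd d y, by simpa [natAdd_eq_iff] using hxy, ?_⟩
      refine Equiv.ext (Fin.addCases (fun z => ?_) fun z => ?_)
      · rw [r1, Equiv.swap_apply_of_ne_of_ne (Cfg.castAdd_ne_natAdd _ _)
          (Cfg.castAdd_ne_natAdd _ _)]
      · rw [r2, (Fin.natAdd_injective ν d).map_swap]
  · rintro _ (⟨τ, hτ, rfl⟩ | ⟨τ, hτ, rfl⟩) _ (⟨ρ, hρ, rfl⟩ | ⟨ρ, hρ, rfl⟩) hne
    · have h := hd hτ hρ fun h => hne (by rw [h])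
      refine Fin.addCases (fun x => ?_) (fun i => Or.inl (l2 τ i))
      rw [l1, l1, castAdd_eq_iff, castAdd_eq_iff]
      exact h x
    · exact hlr _ _
    · exact (hlr _ _).symm
    · have h := hd' hτ hρ fun h => hne (by rw [h])
      refine Fin.addCases (fun x => Or.inl (r1 τ x)) (fun i => ?_)
      rw [r2, r2, natAdd_eq_iff, natAdd_eq_iff]
      exact h i
  · rw [Subgroup.closure_union, ← MonoidHom.map_closure, ← MonoidHom.map_closure,
      ← Subgroup.map_map, ← Subgroup.map_map, ← Subgroup.map_sup]
    congr 1
    refine le_antisymm ?_ (sup_le ?_ ?_)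
    · rintro ⟨x, y⟩ ⟨hx, hy⟩
      rw [← mul_one x, ← one_mul y, ← Prod.mk_mul_mk]
      exact mul_mem (Subgroup.mem_sup_left ⟨x, hx, rfl⟩) (Subgroup.mem_sup_right ⟨y, hy, rfl⟩)
    · rintro _ ⟨x, hx, rfl⟩
      exact ⟨hx, one_mem _⟩
    · rintro _ ⟨x, hx, rfl⟩
      exact ⟨one_mem _, hx⟩
  · rw [← Nat.card_congr (Subgroup.equivMapOfInjective _ _ lift_injective).toEquiv,
      Nat.card_congr (Subgroup.prodEquiv _ _).toEquiv, Nat.card_prod, hj, hk, pow_add]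

lemma Cfg.perm_source {d : ℕ} {c : Cfg d} {a : Fin d} (ha : IsDistinguished c.words a)
    {σ : Equiv.Perm (Fin d)} (hσ : σ ∈ stab c.words) : σ a = a := by
  refine isDistinguished_unique ha ?_
  have h : σ • c.words = c.words := hσ
  rw [← h]
  exact ⟨(smul_mem_loops σ _ _).2 ha.1, (m_smul σ _ _).trans ha.2⟩

lemma stab_one : stab oneCfg.words = ⊥ := Subsingleton.elim _ _

lemma stab_two : stab twoCfg.words = ⊥ := by
  rw [Subgroup.eq_bot_iff_forall]
  intro σ hσ
  have h : σ 0 = 0 := by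
    refine Cfg.perm_source (Cfg.isDistinguished_iff.2 ⟨mem_univ _, fun x hx => ?_⟩) hσ
    have : x = 1 := by omega
    subst this
    simp [twoCfg]
  have : ∀ σ : Equiv.Perm (Fin 2), σ 0 = 0 → σ = 1 := by decide
  exact this σ h

/-! ### Sequences of operations -/

/-- The number of operations in a list that add two digits. -/
def pairs (l : List Op) : ℕ := (l.map fun o => o.deg - 1).sum

/-- The alphabet size that results from a starting point and a list of operations. -/
def size (p : Seed × List Op) : ℕ := p.1.start.1 + (p.2.map Op.deg).sum

lemma run_append (s : Seed) (l : List Op) (o : Op) :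
    run s (l ++ [o]) = ⟨(run s l).1 + o.deg, o.onOrbit (run s l).2⟩ := by
  simp [run]

lemma Seed.exists_cfg_stab (s : Seed) : ∃ (n : ℕ) (c : Cfg n), 0 < n ∧ c.val = alpha n ∧
    s.start = ⟨n, orbit c.words⟩ ∧ SwapGenerated (stab c.words) 0 := by
  cases s
  · exact ⟨1, oneCfg, one_pos, val_one, start_one, stab_one ▸ swapGenerated_bot⟩
  · exact ⟨2, twoCfg, two_pos, val_two, start_two, stab_two ▸ swapGenerated_bot⟩

theorem exists_cfg_run (s : Seed) (l : List Op) : ∃ (n : ℕ) (c : Cfg n), 0 < n ∧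
    c.val = alpha n ∧ run s l = ⟨n, orbit c.words⟩ ∧ n = size (s, l) ∧
    SwapGenerated (stab c.words) (pairs l) := by
  induction l using List.reverseRecOn with
  | nil =>
    obtain ⟨n, c, hn, hc, hs, hG⟩ := s.exists_cfg_stab
    exact ⟨n, c, hn, hc, hs, by simp [size, hs], hG⟩
  | append_singleton l o ih =>
    obtain ⟨n, c, hn, hc, hs, hz, hG⟩ := ih
    refine ⟨n + o.deg, c.ext o.deg o.primed, by omega, Cfg.val_ext_eq_alpha hc o, ?_, ?_, ?_⟩
    · rw [run_append, hs, Cfg.onOrbit_eq hc, Cfg.apply_words hc]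
    · rw [hz]
      simp [size, add_assoc]
    · rw [← Cfg.apply_words hc, Cfg.stab_apply hc]
      have := hG.map_lift (swapGenerated_top o.deg_eq)
      simpa [pairs] using this

/-- Strip the last operation by `Cfg.apply_injective`; the seeds themselves differ in alphabet size.
-/
theorem run_injective {p p' : Seed × List Op} (h : run p.1 p.2 = run p'.1 p'.2) : p = p' := by
  obtain ⟨s, l⟩ := p
  obtain ⟨s', l'⟩ := p'
  simp only at h
  have hne : ∀ (s s' : Seed) (l : List Op) (o : Op), run s (l ++ [o]) ≠ s'.start := by
    intro s s' l o
    obtain ⟨n, c, hn, hc, hs, -⟩ := exists_cfg_run s l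
    rw [run_append, hs, Cfg.onOrbit_eq hc]
    exact Cfg.apply_ne_start hc o s'
  induction l using List.reverseRecOn generalizing l' with
  | nil =>
    rcases List.eq_nil_or_concat l' with rfl | ⟨l', o, rfl⟩
    · have : s = s' := by
        have h1 : s.start.1 = s'.start.1 := congrArg Sigma.fst h
        cases s <;> cases s' <;> simp [Seed.start] at h1 ⊢
      rw [this]
    · rw [List.concat_eq_append] at h
      exact absurd h.symm (hne s' s l' o)
  | append_singleton l o ih =>
    rcases List.eq_nil_or_concat l' with rfl | ⟨l', o', rfl⟩
    · exact absurd h (hne s s' l o)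
    · obtain ⟨n, c, hn, hc, hs, -⟩ := exists_cfg_run s l
      obtain ⟨n', c', hn', hc', hs', -⟩ := exists_cfg_run s' l'
      rw [List.concat_eq_append, run_append, run_append, hs, hs', Cfg.onOrbit_eq hc,
        Cfg.onOrbit_eq hc'] at h
      obtain ⟨rfl, h'⟩ := Cfg.apply_injective hc hc' h
      rw [← hs, ← hs'] at h'
      obtain ⟨rfl, rfl⟩ := Prod.mk.inj (ih l' h')
      simp

theorem exists_run {n : ℕ} (c : Cfg n) (h : c.val = alpha n) :
    ∃ p : Seed × List Op, run p.1 p.2 = ⟨n, orbit c.words⟩ := by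
  induction n using Nat.strong_induction_on with
  | _ n ih =>
    have hle := card_le_univ c.X
    rw [Fintype.card_fin] at hle
    rcases hle.lt_or_eq with hlt | heq
    · obtain ⟨d, o, c', hd, hc', e⟩ := Cfg.exists_apply h hlt
      have hn : n = d + o.deg := congrArg Sigma.fst e
      have := o.deg_eq
      obtain ⟨⟨s, l⟩, hp⟩ := ih d (by omega) c' hc'
      refine ⟨(s, l ++ [o]), ?_⟩
      simp only at hp
      rw [e, run_append, hp, Cfg.onOrbit_eq hc']
    · obtain ⟨s, hs⟩ := Cfg.exists_seed h heq
      exact ⟨(s, []), hs⟩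

/-! ### Enumeration of sequences and orbits -/

/-- Prefixing an operation to the list. -/
def consOp (o : Op) : Seed × List Op ↪ Seed × List Op :=
  ⟨fun p => (p.1, o :: p.2), fun p p' h => by simpa [Prod.ext_iff] using h⟩

/-- The starting points and lists of operations that result in the alphabet size `d`. -/
noncomputable def runs : ℕ → Finset (Seed × List Op)
  | 0 => ∅
  | 1 => {(.one, [])}
  | d + 2 => (if d = 0 then {(.two, [])} else ∅) ∪ (((runs (d + 1)).map (consOp .f) ∪
      (runs (d + 1)).map (consOp .f')) ∪ ((runs d).map (consOp .g) ∪ (runs d).map (consOp .g')))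

lemma size_cons (s : Seed) (o : Op) (l : List Op) : size (s, o :: l) = size (s, l) + o.deg := by
  simp [size]; ring

lemma size_pos (p : Seed × List Op) : 0 < size p := by
  obtain ⟨s, l⟩ := p
  cases s <;> simp [size, Seed.start]

lemma mem_map_consOp {A : Finset (Seed × List Op)} {o : Op} {s : Seed} {l : List Op} :
    (s, l) ∈ A.map (consOp o) ↔ ∃ l', l = o :: l' ∧ (s, l') ∈ A := by
  rw [mem_map]
  constructor
  · rintro ⟨⟨s', l'⟩, h, e⟩
    obtain ⟨rfl, rfl⟩ := Prod.mk.inj e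
    exact ⟨l', rfl, h⟩
  · rintro ⟨l', rfl, h⟩; exact ⟨(s, l'), h, rfl⟩

/-- The recursion splits off the first operation although orbits are built at the end of the list;
this is harmless because the size ignores order. -/
lemma mem_runs {d : ℕ} : ∀ {s : Seed} {l : List Op}, (s, l) ∈ runs d ↔ size (s, l) = d := by
  induction d using Nat.strong_induction_on with
  | _ d ih =>
    intro s l
    match d with
    | 0 =>
      have := size_pos (s, l)
      simp [runs, this.ne']
    | 1 =>
      cases l with
      | nil => cases s <;> simp [runs, size, Seed.start]
      | cons o l =>
        have := size_pos (s, l)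
        have := o.deg_eq
        rw [size_cons]
        simp only [runs, mem_singleton, Prod.mk.injEq, reduceCtorEq, and_false, false_iff]
        omega
    | d + 2 =>
      have h1 := fun s l => ih (d + 1) (by omega) (s := s) (l := l)
      have h0 := fun s l => ih d (by omega) (s := s) (l := l)
      simp only [runs, mem_union, mem_map_consOp, h1, h0]
      cases l with
      | nil => cases s <;> by_cases hd : d = 0 <;> simp [size, Seed.start, hd]
      | cons o l =>
        rw [size_cons]
        have : (s, o :: l) ∉ (if d = 0 then {(Seed.two, [])} else ∅ : Finset (Seed × List Op)) := by
          split_ifs <;> simp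
        simp only [this, false_or]
        cases o <;> simp [Op.deg]

lemma sum_runs {M : Type*} [AddCommMonoid M] (h : Seed × List Op → M) (d : ℕ) :
    ∑ p ∈ runs (d + 2), h p = (if d = 0 then h (.two, []) else 0) +
      ((∑ p ∈ runs (d + 1), h (consOp .f p) + ∑ p ∈ runs (d + 1), h (consOp .f' p)) +
      (∑ p ∈ runs d, h (consOp .g p) + ∑ p ∈ runs d, h (consOp .g' p))) := by
  have hd : ∀ {o o' : Op} {A B : Finset (Seed × List Op)}, o ≠ o' →
      Disjoint (A.map (consOp o)) (B.map (consOp o')) := by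
    intro o o' A B hne
    rw [disjoint_left]
    rintro ⟨s, l⟩ h1 h2
    obtain ⟨l', rfl, -⟩ := mem_map_consOp.1 h1
    obtain ⟨l'', h, -⟩ := mem_map_consOp.1 h2
    exact hne (List.cons.inj h).1
  have hs : ∀ {o : Op} {A : Finset (Seed × List Op)},
      Disjoint (if d = 0 then {(Seed.two, [])} else ∅) (A.map (consOp o)) := by
    intro o A
    rw [disjoint_right]
    rintro ⟨s, l⟩ h1 h2
    obtain ⟨l', rfl, -⟩ := mem_map_consOp.1 h1
    split_ifs at h2 <;> simp at h2
  rw [runs, sum_union, sum_union, sum_union, sum_union, sum_map, sum_map, sum_map, sum_map]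
  · congr 1
    split_ifs <;> simp
  · exact hd (by simp)
  · exact hd (by simp)
  · simp only [disjoint_union_left, disjoint_union_right]
    exact ⟨⟨hd (by simp), hd (by simp)⟩, ⟨hd (by simp), hd (by simp)⟩⟩
  · simp only [disjoint_union_right]
    exact ⟨⟨hs, hs⟩, ⟨hs, hs⟩⟩

/-- The orbit, if the alphabet has size `d`. -/
def part (d : ℕ) (R : SizedOrbit) : Set (Set (Word d)) := {S | ∃ Ω, R = ⟨d, Ω⟩ ∧ S ∈ Ω}

lemma part_mk {d : ℕ} (Ω : Set (Set (Word d))) : part d ⟨d, Ω⟩ = Ω := by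
  ext S
  constructor
  · rintro ⟨Ω', h, hS⟩
    rw [eq_of_heq (Sigma.mk.inj h).2]
    exact hS
  · intro hS
    exact ⟨Ω, rfl, hS⟩

lemma exists_cfg_of_mem_runs {d : ℕ} {p : Seed × List Op} (h : p ∈ runs d) : ∃ c : Cfg d,
    0 < d ∧ c.val = alpha d ∧ run p.1 p.2 = ⟨d, orbit c.words⟩ ∧
    SwapGenerated (stab c.words) (pairs p.2) := by
  obtain ⟨n, c, hn, hc, hr, hz, hG⟩ := exists_cfg_run p.1 p.2
  obtain rfl : n = d := hz.trans (mem_runs.1 h)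
  exact ⟨c, hn, hc, hr, hG⟩

lemma exists_mem_runs {d : ℕ} (c : Cfg d) (h : c.val = alpha d) :
    ∃ p ∈ runs d, run p.1 p.2 = ⟨d, orbit c.words⟩ := by
  obtain ⟨⟨s, l⟩, hp⟩ := exists_run c h
  obtain ⟨n, c', hn, hc, hr, hz, hG⟩ := exists_cfg_run s l
  refine ⟨(s, l), mem_runs.2 ?_, hp⟩
  rw [← hz]
  exact congrArg Sigma.fst (hr.symm.trans hp)

lemma SwapGenerated.of_mem_orbit {d k : ℕ} {S S' : Set (Word d)} (h : SwapGenerated (stab S) k)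
    (hS' : S' ∈ orbit S) : SwapGenerated (stab S') k := by
  obtain ⟨σ, rfl⟩ := hS'
  have := h.map_conj σ
  rwa [← Cfg.stab_smul] at this

lemma part_run_injOn (d : ℕ) :
    Set.InjOn (fun p : Seed × List Op => part d (run p.1 p.2)) (runs d) := by
  intro p hp p' hp' h
  obtain ⟨c, -, -, hr, -⟩ := exists_cfg_of_mem_runs (mem_coe.1 hp)
  obtain ⟨c', -, -, hr', -⟩ := exists_cfg_of_mem_runs (mem_coe.1 hp')
  simp only [hr, hr', part_mk] at h
  apply run_injective
  rw [hr, hr', h]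

theorem b_eq {d : ℕ} (hd : 0 < d) (k : ℕ) : b d k = #{p ∈ runs d | pairs p.2 = k} := by
  rw [b, ← Set.ncard_coe_finset, ← ((part_run_injOn d).mono
    (coe_subset.2 (filter_subset (fun p => pairs p.2 = k) _))).ncard_image]
  congr 1
  ext Ω
  simp only [Set.mem_ofPred_eq, Set.mem_image, mem_coe, mem_filter]
  constructor
  · rintro ⟨⟨S, hS, rfl⟩, hk⟩
    obtain ⟨c, rfl, hc⟩ := (isMIS_iff hd).1 hS
    obtain ⟨p, hp, hr⟩ := exists_mem_runs c hc
    obtain ⟨c', -, -, hr', hG⟩ := exists_cfg_of_mem_runs hp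
    refine ⟨p, ⟨hp, ?_⟩, by rw [hr, part_mk]⟩
    have he : orbit c.words = orbit c'.words := by rw [← part_mk (orbit c.words), ← hr, hr', part_mk]
    have := hk c'.words (he ▸ MulAction.mem_orbit_self _)
    rw [hG.2] at this
    exact Nat.pow_right_injective le_rfl this
  · rintro ⟨p, ⟨hp, rfl⟩, rfl⟩
    obtain ⟨c, -, hc, hr, hG⟩ := exists_cfg_of_mem_runs hp
    rw [hr, part_mk]
    exact ⟨⟨_, (isMIS_iff hd).2 ⟨c, rfl, hc⟩, rfl⟩, fun S hS => (hG.of_mem_orbit hS).2⟩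

theorem a_eq_sum {d : ℕ} (hd : 0 < d) :
    a d = ∑ p ∈ runs d, (part d (run p.1 p.2)).ncard := by
  have : {S : Set (Word d) | IsMIS S} =
      ↑((runs d).biUnion fun p => (part d (run p.1 p.2)).toFinite.toFinset) := by
    ext S
    simp only [Set.mem_ofPred_eq, coe_biUnion, Set.Finite.coe_toFinset, Set.mem_iUnion, mem_coe,
      exists_prop]
    rw [isMIS_iff hd]
    constructor
    · rintro ⟨c, rfl, hc⟩
      obtain ⟨p, hp, hr⟩ := exists_mem_runs c hc
      exact ⟨p, hp, by rw [hr, part_mk]; exact MulAction.mem_orbit_self _⟩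
    · rintro ⟨p, hp, hS⟩
      obtain ⟨c, -, hc, hr, -⟩ := exists_cfg_of_mem_runs hp
      rw [hr, part_mk] at hS
      obtain ⟨σ, rfl⟩ := hS
      exact ⟨c.perm σ, c.words_perm σ, (c.val_perm σ).trans hc⟩
  rw [a, this, Set.ncard_coe_finset, card_biUnion]
  · exact sum_congr rfl fun p _ => (Set.ncard_eq_toFinset_card _).symm
  · intro p hp p' hp' hne
    obtain ⟨c, -, -, hr, -⟩ := exists_cfg_of_mem_runs hp
    obtain ⟨c', -, -, hr', -⟩ := exists_cfg_of_mem_runs hp'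
    rw [Function.onFun, Set.Finite.disjoint_toFinset, Set.disjoint_left]
    intro S hS hS'
    refine hne (part_run_injOn d hp hp' ?_)
    simp only [hr, hr', part_mk] at hS hS' ⊢
    exact (MulAction.orbit_eq_iff.2 hS).symm.trans (MulAction.orbit_eq_iff.2 hS')

/-! ### Recurrences and generating functions -/

/-- The number of MISs of `B(d,3)`, divided by `d!`. -/
noncomputable def ratio (d : ℕ) : ℚ := ∑ p ∈ runs d, 1 / 2 ^ pairs p.2

/-- Orbit-stabilizer, applied to each sequence. -/
theorem a_eq {d : ℕ} (hd : 0 < d) : (a d : ℚ) = d.factorial * ratio d := by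
  rw [a_eq_sum hd, ratio, mul_sum, Nat.cast_sum]
  refine sum_congr rfl fun p hp => ?_
  obtain ⟨c, -, -, hr, hG⟩ := exists_cfg_of_mem_runs hp
  have h := (stab c.words).card_mul_index
  rw [hG.2, MulAction.index_stabilizer, Nat.card_perm, Nat.card_fin] at h
  rw [hr, part_mk, ← h]
  push_cast
  field_simp

lemma pairs_consOp (o : Op) (p : Seed × List Op) :
    pairs (consOp o p).2 = (o.deg - 1) + pairs p.2 := by
  change pairs (o :: p.2) = _
  simp [pairs]

lemma ratio_zero : ratio 0 = 0 := by simp [ratio, runs]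

lemma ratio_one : ratio 1 = 1 := by simp [ratio, runs, pairs]

/-- The operations g and g' each halve the weight, so together they contribute `ratio d` once; the
second seed enters at d = 0. -/
lemma ratio_add_two (d : ℕ) :
    ratio (d + 2) = (if d = 0 then 1 else 0) + 2 * ratio (d + 1) + ratio d := by
  have h1 : ∀ p, pairs (consOp .f p).2 = pairs p.2 := fun p => (pairs_consOp _ p).trans (zero_add _)
  have h2 : ∀ p, pairs (consOp .f' p).2 = pairs p.2 := fun p => (pairs_consOp _ p).trans (zero_add _)
  have h3 : ∀ p, pairs (consOp .g p).2 = 1 + pairs p.2 := pairs_consOp _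
  have h4 : ∀ p, pairs (consOp .g' p).2 = 1 + pairs p.2 := pairs_consOp _
  have h5 : ratio d = 2 * ∑ p ∈ runs d, 1 / 2 ^ (1 + pairs p.2) := by
    rw [ratio, mul_sum]
    exact sum_congr rfl fun p _ => by rw [pow_add]; field_simp
  rw [h5, ratio, sum_runs, ratio]
  simp only [h1, h2, h3, h4]
  simp [pairs]
  ring

/-- The number of starting points and lists of operations that yield orbits of MISs of `B(d,3)`
with stabilizers of order `2 ^ k`. -/
noncomputable def count (d k : ℕ) : ℕ := #{p ∈ runs d | pairs p.2 = k}

lemma count_zero (k : ℕ) : count 0 k = 0 := by simp [count, runs]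

lemma count_one (k : ℕ) : count 1 k = if k = 0 then 1 else 0 := by
  have h : pairs [] = 0 := rfl
  rw [count, runs, filter_singleton]
  simp only [h, eq_comm (a := 0)]
  split_ifs <;> rfl

lemma count_add_two (d k : ℕ) : count (d + 2) k = (if d = 0 ∧ k = 0 then 1 else 0) +
    2 * count (d + 1) k + if k = 0 then 0 else 2 * count d (k - 1) := by
  have h1 : ∀ p, pairs (consOp .f p).2 = pairs p.2 := fun p => (pairs_consOp _ p).trans (zero_add _)
  have h2 : ∀ p, pairs (consOp .f' p).2 = pairs p.2 := fun p => (pairs_consOp _ p).trans (zero_add _)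
  have h3 : ∀ p, pairs (consOp .g p).2 = 1 + pairs p.2 := pairs_consOp _
  have h4 : ∀ p, pairs (consOp .g' p).2 = 1 + pairs p.2 := pairs_consOp _
  have h5 : pairs [] = 0 := rfl
  simp only [count, card_filter]
  rw [sum_runs]
  simp only [h1, h2, h3, h4, h5]
  rcases k with _ | k
  · simp
    ring
  · have : ∀ j, 1 + j = k + 1 ↔ j = k := fun j => by omega
    simp [this]
    ring

lemma count_two (k : ℕ) : count 2 k = if k = 0 then 3 else 0 := by
  rw [count_add_two 0, count_one]
  by_cases h : k = 0 <;> simp [h, count_zero]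

lemma b_eq_count {d : ℕ} (hd : 0 < d) (k : ℕ) : b d k = count d k := b_eq hd k

theorem aSeries_eq : aSeries = (PowerSeries.X + PowerSeries.X ^ 2) *
    (1 - 2 * PowerSeries.X - PowerSeries.X ^ 2)⁻¹ := by
  have h0 : aSeries = PowerSeries.mk ratio := by
    ext d
    rw [aSeries, PowerSeries.coeff_mk, PowerSeries.coeff_mk]
    split_ifs with h
    · rw [h, ratio_zero]
    · rw [a_eq (Nat.pos_of_ne_zero h)]
      field_simp
  rw [PowerSeries.eq_mul_inv_iff_mul_eq (by simp), h0]
  have e : PowerSeries.mk ratio * (1 - 2 * PowerSeries.X - PowerSeries.X ^ 2) =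
      PowerSeries.mk ratio - (PowerSeries.C (2 : ℚ) * PowerSeries.mk ratio) * PowerSeries.X -
        PowerSeries.mk ratio * PowerSeries.X ^ 2 := by
    rw [map_ofNat]; ring
  rw [e]
  ext d
  simp only [map_sub, map_add]
  rcases d with _ | _ | d
  · simp [ratio_zero, PowerSeries.coeff_X_pow, PowerSeries.coeff_mul_X_pow']
  · simp [ratio_one, ratio_zero, PowerSeries.coeff_succ_mul_X, PowerSeries.coeff_X_pow,
      PowerSeries.coeff_mul_X_pow', PowerSeries.coeff_one_X]
  · rw [PowerSeries.coeff_succ_mul_X, PowerSeries.coeff_mul_X_pow _ 2 d, PowerSeries.coeff_C_mul,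
      PowerSeries.coeff_mk, PowerSeries.coeff_mk, PowerSeries.coeff_mk, PowerSeries.coeff_X,
      PowerSeries.coeff_X_pow, ratio_add_two]
    rcases d with _ | d
    · simp
      ring
    · simp

theorem bSeries_eq : bSeries = (t + t ^ 2) * (1 - 2 * t - 2 * t ^ 2 * s)⁻¹ := by
  have h0 : ∀ e, MvPowerSeries.coeff e bSeries = (count (e 0) (e 1) : ℚ) := by
    intro e
    change (if e 0 = 0 then 0 else (b (e 0) (e 1) : ℚ)) = _
    split_ifs with h
    · rw [h, count_zero, Nat.cast_zero]
    · rw [b_eq_count (Nat.pos_of_ne_zero h)]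
  have ht : t = MvPowerSeries.monomial (Finsupp.single 0 1) (1 : ℚ) := rfl
  have ht2 : t ^ 2 = MvPowerSeries.monomial (Finsupp.single 0 2) (1 : ℚ) :=
    MvPowerSeries.X_pow_eq _ _
  have hts : t ^ 2 * s =
      MvPowerSeries.monomial (Finsupp.single 0 2 + Finsupp.single 1 1) (1 : ℚ) := by
    rw [ht2, s, MvPowerSeries.X, MvPowerSeries.monomial_mul_monomial, one_mul]
  rw [MvPowerSeries.eq_mul_inv_iff_mul_eq (by simp [t, s])]
  -- Doubling is written as a sum so that every factor is a monomial with coefficient 1.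
  have e1 : bSeries * (1 - 2 * t - 2 * t ^ 2 * s) = bSeries - (bSeries * t + bSeries * t) -
      (bSeries * (t ^ 2 * s) + bSeries * (t ^ 2 * s)) := by ring
  rw [e1, hts, ht2, ht]
  ext e
  simp only [map_sub, map_add, MvPowerSeries.coeff_mul_monomial, h0, mul_one,
    MvPowerSeries.coeff_monomial, Finsupp.le_def, Finsupp.ext_iff, Fin.forall_fin_two,
    Finsupp.coe_tsub, Finsupp.coe_add, Pi.sub_apply, Pi.add_apply]
  simp only [Finsupp.single_apply]
  generalize e 0 = d
  generalize e 1 = k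
  rcases d with _ | _ | d
  · simp [count_zero]
  · simp [count_zero, count_one]
  · simp [count_add_two]
    rcases k with _ | k
    · simp
      ring
    · simp
      ring

lemma a_add_three (d : ℕ) :
    a (d + 3) = 2 * (d + 3) * a (d + 2) + (d + 3) * (d + 2) * a (d + 1) := by
  have h3 := a_eq (d := d + 3) (by omega)
  have h2 := a_eq (d := d + 2) (by omega)
  have h1 := a_eq (d := d + 1) (by omega)
  rw [ratio_add_two (d + 1)] at h3
  have : ((a (d + 3) : ℕ) : ℚ) =
      ((2 * (d + 3) * a (d + 2) + (d + 3) * (d + 2) * a (d + 1) : ℕ) : ℚ) := by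
    push_cast
    rw [h3, h2, h1, Nat.factorial_succ (d + 2), Nat.factorial_succ (d + 1)]
    push_cast
    simp
    ring
  exact_mod_cast this

end DeBruijn

theorem mainTheorem1 :
    -- the distinguished loop is well defined, and the operations act on orbits of MISs
    (∀ d : ℕ, 0 < d → ∀ S : Set (DeBruijn.Word d), DeBruijn.IsMIS S →
      ∃! a, DeBruijn.IsDistinguished S a) ∧
    (∀ d : ℕ, 0 < d → ∀ (o : DeBruijn.Op) (S : Set (DeBruijn.Word d)), DeBruijn.IsMIS S →
      DeBruijn.IsMIS (o.apply S) ∧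
      o.onOrbit (DeBruijn.orbit S) = DeBruijn.orbit (o.apply S)) ∧
    -- every sequence of operations yields an orbit of MISs, and every orbit of MISs arises
    -- from exactly one starting point and one sequence
    (∀ (s : DeBruijn.Seed) (l : List DeBruijn.Op),
      0 < (DeBruijn.run s l).1 ∧ DeBruijn.IsMISOrbit (DeBruijn.run s l).2) ∧
    (∀ d : ℕ, 0 < d → ∀ Ω : Set (Set (DeBruijn.Word d)), DeBruijn.IsMISOrbit Ω →
      ∃! p : DeBruijn.Seed × List DeBruijn.Op, DeBruijn.run p.1 p.2 = ⟨d, Ω⟩) ∧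
    -- stabilizers
    (∀ d : ℕ, 0 < d → ∀ S : Set (DeBruijn.Word d), DeBruijn.IsMIS S →
      (∃ T : Set (Equiv.Perm (Fin d)), (∀ τ ∈ T, τ.IsSwap) ∧
        T.Pairwise Equiv.Perm.Disjoint ∧ DeBruijn.stab S = Subgroup.closure T) ∧
      ∃ k : ℕ, Nat.card (DeBruijn.stab S) = 2 ^ k) ∧
    -- the numbers of orbits
    (DeBruijn.b 1 0 = 1 ∧ DeBruijn.b 2 0 = 3 ∧
      (∀ k : ℕ, 1 ≤ k → DeBruijn.b 1 k = 0 ∧ DeBruijn.b 2 k = 0) ∧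
      (∀ d : ℕ, 3 ≤ d → DeBruijn.b d 0 = 2 * DeBruijn.b (d - 1) 0) ∧
      (∀ d k : ℕ, 3 ≤ d → 1 ≤ k →
        DeBruijn.b d k = 2 * DeBruijn.b (d - 1) k + 2 * DeBruijn.b (d - 2) (k - 1)) ∧
      DeBruijn.bSeries = (DeBruijn.t + DeBruijn.t ^ 2) *
        (1 - 2 * DeBruijn.t - 2 * DeBruijn.t ^ 2 * DeBruijn.s)⁻¹) ∧
    -- the numbers of maximum independent sets
    (DeBruijn.a 1 = 1 ∧ DeBruijn.a 2 = 6 ∧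
      (∀ d : ℕ, 3 ≤ d → DeBruijn.a d =
        2 * d * DeBruijn.a (d - 1) + d * (d - 1) * DeBruijn.a (d - 2)) ∧
      DeBruijn.aSeries = (PowerSeries.X + PowerSeries.X ^ 2) *
        (1 - 2 * PowerSeries.X - PowerSeries.X ^ 2)⁻¹) := by
  refine ⟨fun d hd S hS => ?_, fun d hd o S hS => ?_, fun s l => ?_, fun d hd Ω hΩ => ?_,
    fun d hd S hS => ?_, ⟨?_, ?_, fun k hk => ⟨?_, ?_⟩, fun d hd => ?_, fun d k hd hk => ?_,
    DeBruijn.bSeries_eq⟩, ?_, ?_, fun d hd => ?_, DeBruijn.aSeries_eq⟩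
  · obtain ⟨c, rfl, hc⟩ := (DeBruijn.isMIS_iff hd).1 hS
    obtain ⟨a, ha⟩ := c.exists_isDistinguished hc
    exact ⟨a, ha, fun a' => DeBruijn.Cfg.isDistinguished_unique ha⟩
  · obtain ⟨c, rfl, hc⟩ := (DeBruijn.isMIS_iff hd).1 hS
    refine ⟨?_, DeBruijn.Cfg.onOrbit_eq hc o⟩
    exact (DeBruijn.isMIS_iff (Nat.add_pos_left hd _)).2
      ⟨_, (DeBruijn.Cfg.apply_words hc o).symm, DeBruijn.Cfg.val_ext_eq_alpha hc o⟩
  · obtain ⟨n, c, hn, hc, hr, -⟩ := DeBruijn.exists_cfg_run s l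
    rw [hr]
    exact ⟨hn, _, (DeBruijn.isMIS_iff hn).2 ⟨c, rfl, hc⟩, rfl⟩
  · obtain ⟨S, hS, rfl⟩ := hΩ
    obtain ⟨c, rfl, hc⟩ := (DeBruijn.isMIS_iff hd).1 hS
    obtain ⟨p, hp⟩ := DeBruijn.exists_run c hc
    exact ⟨p, hp, fun p' hp' => DeBruijn.run_injective (hp'.trans hp.symm)⟩
  · obtain ⟨c, rfl, hc⟩ := (DeBruijn.isMIS_iff hd).1 hS
    obtain ⟨p, hp, hr⟩ := DeBruijn.exists_mem_runs c hc
    obtain ⟨c', -, -, hr', hG⟩ := DeBruijn.exists_cfg_of_mem_runs hp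
    have he := eq_of_heq (Sigma.mk.inj (hr.symm.trans hr')).2
    have hG := hG.of_mem_orbit (S' := c.words) (by rw [← he]; exact MulAction.mem_orbit_self _)
    exact ⟨hG.1, _, hG.2⟩
  · rw [DeBruijn.b_eq_count one_pos, DeBruijn.count_one, if_pos rfl]
  · rw [DeBruijn.b_eq_count two_pos, DeBruijn.count_two, if_pos rfl]
  · rw [DeBruijn.b_eq_count one_pos, DeBruijn.count_one, if_neg (by omega)]
  · rw [DeBruijn.b_eq_count two_pos, DeBruijn.count_two, if_neg (by omega)]
  · obtain ⟨d, rfl⟩ := Nat.exists_eq_add_of_le' hd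
    rw [DeBruijn.b_eq_count (by omega), DeBruijn.b_eq_count (by omega)]
    simp [DeBruijn.count_add_two (d + 1)]
  · obtain ⟨d, rfl⟩ := Nat.exists_eq_add_of_le' hd
    rw [DeBruijn.b_eq_count (by omega), DeBruijn.b_eq_count (by omega),
      DeBruijn.b_eq_count (by omega)]
    have : k ≠ 0 := by omega
    simp [DeBruijn.count_add_two (d + 1), this]
  · have h := DeBruijn.a_eq one_pos
    rw [DeBruijn.ratio_one] at h
    exact_mod_cast h.trans (by simp : _ = (1 : ℚ))
  · have h := DeBruijn.a_eq two_pos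
    rw [show DeBruijn.ratio 2 = _ from DeBruijn.ratio_add_two 0, DeBruijn.ratio_zero,
      DeBruijn.ratio_one] at h
    exact_mod_cast h.trans (by norm_num [Nat.factorial] : _ = (6 : ℚ))
  · obtain ⟨d, rfl⟩ := Nat.exists_eq_add_of_le' hd
    exact DeBruijn.a_add_three d
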